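/- All graphs are finite and simple. Write $P_m$ for the path on $m$ vertices, $K_m$ for the complete graph on $m$ vertices, $mH$ for the disjoint union of $m$ copies of $H$, and $G_1\vee G_2$ for the join of $G_1$ and $G_2$ (their disjoint union together with all edges between $G_1$ and $G_2$). A graph contains $F$ if it has a (not necessarily induced) subgraph isomorphic to $F$, and it is $F$-free otherwise. A graph is outerplanar if it can be drawn in the plane without crossings so that every vertex lies on the boundary of the outer face. Let $\rho(G)$ be the spectral radius of the adjacency matrix of $G$, and let $\mathrm{spex}_{\mathcal{OP}}(n,F)$ be the maximum of $\rho(G)$ over all $F$-free outerplanar graphs $G$ on $n$ vertices; an extremal graph for $\mathrm{spex}_{\mathcal{OP}}(n,F)$ is an $F$-free outerplanar graph on $n$ vertices that attains this maximum. **Theorem.** Let $n$ and $t$ be integers with $1\le t\le\frac{n-1}{2}$, and let $F$ be an outerplanar graph that is contained in $K_1\vee P_{n-1}$ but not in $K_1\vee\big((t-1)K_2\cup(n-2t+1)K_1\big)$. Suppose that $$n\ \ge\ \max\Big\{1.27\times10^7,\ \big[(64+|V(F)|)^{1/2}+8\big]^2\Big\}.$$ Let $G$ be a connected extremal graph for $\mathrm{spex}_{\mathcal{OP}}(n,F)$,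 and let $X=(x_v)_{v\in V(G)}$ be the positive eigenvector of the adjacency matrix of $G$ for the eigenvalue $\rho(G)$ with $\max_{v\in V(G)}x_v=1$. Then there is a vertex $u\in V(G)$ such that $N_G(u)=V(G)\setminus\{u\}$ and $x_u=1$. In particular: (i) $G$ contains a copy of $K_{1,n-1}$; (ii) the induced subgraph $G[N_G(u)]$ is a disjoint union of paths (a single vertex counts as a path). -/

import Mathlib

namespace Spex

/-! ### Joins, disjoint unions and linear forests -/

/-- The join `G ∨ H`: the disjoint union of `G` and `H` together with all edges between them. -/
def join {V W : Type*} (G : SimpleGraph V) (H : SimpleGraph W) : SimpleGraph (V ⊕ W) :=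
  (G.sum H) ⊔ completeBipartiteGraph V W

/-- The disjoint union of a family of graphs. -/
def disjointUnion {ι : Type*} {V : ι → Type*} (G : ∀ i, SimpleGraph (V i)) :
    SimpleGraph (Σ i, V i) :=
  ⨆ i, (G i).map (Function.Embedding.sigmaMk i)

/-- `K_1 ∨ P_{n-1}`. -/
def fan (n : ℕ) : SimpleGraph (Fin 1 ⊕ Fin (n - 1)) :=
  join (⊥ : SimpleGraph (Fin 1)) (SimpleGraph.pathGraph (n - 1))

/-- `K_1 ∨ ((t-1) K_2 ∪ (n-2t+1) K_1)`; it is used for `1 ≤ t ≤ (n-1)/2` only. -/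
def matchingCone (n t : ℕ) :
    SimpleGraph (Fin 1 ⊕ ((Σ _ : Fin (t - 1), Fin 2) ⊕ Fin (n - 2 * t + 1))) :=
  join (⊥ : SimpleGraph (Fin 1))
    (SimpleGraph.sum (disjointUnion fun _ : Fin (t - 1) => (⊤ : SimpleGraph (Fin 2)))
      (⊥ : SimpleGraph (Fin (n - 2 * t + 1))))

/-- `G` is a disjoint union of (finitely many) paths, each with at least one vertex. -/
def IsDisjointUnionOfPaths {V : Type*} (G : SimpleGraph V) : Prop :=
  ∃ (k : ℕ) (l : Fin k → ℕ), (∀ i, 1 ≤ l i) ∧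
    Nonempty (G ≃g disjointUnion fun i => SimpleGraph.pathGraph (l i))

/-! ### Outerplanar graphs -/

/-- The Euclidean plane. -/
abbrev Plane : Type := EuclideanSpace ℝ (Fin 2)

/-- `A` is a simple (Jordan) arc with end points `p` and `q`. -/
def IsArc (A : Set Plane) (p q : Plane) : Prop :=
  ∃ γ : Path p q, Function.Injective γ ∧ Set.range γ = A

/-- A drawing of `G` in the plane without crossings. -/
structure PlaneDrawing {V : Type*} (G : SimpleGraph V) where
  /-- the point that represents a vertex -/
  point : V → Plane
  /-- the arc that represents an edge -/
  arc : G.edgeSet → Set Plane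
  point_injective : Function.Injective point
  isArc : ∀ (u v : V) (h : G.Adj u v), IsArc (arc ⟨s(u, v), h⟩) (point u) (point v)
  mem_of_point_mem_arc : ∀ (v : V) (e : G.edgeSet), point v ∈ arc e → v ∈ (e : Sym2 V)
  /-- two different edges meet at most in vertices -/
  arc_inter_subset : ∀ e e' : G.edgeSet, e ≠ e' → arc e ∩ arc e' ⊆ Set.range point

/-- The set of points covered by the drawing. -/
def PlaneDrawing.support {V : Type*} {G : SimpleGraph V} (D : PlaneDrawing G) : Set Plane :=
  Set.range D.point ∪ ⋃ e, D.arc e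

/-- The outer face: the unbounded connected component of the complement of the drawing. -/
def PlaneDrawing.outerFace {V : Type*} {G : SimpleGraph V} (D : PlaneDrawing G) : Set Plane :=
  {p | p ∈ D.supportᶜ ∧ ¬ Bornology.IsBounded (connectedComponentIn D.supportᶜ p)}

/-- A finite graph is outerplanar if it has a plane drawing in which every vertex lies on the
boundary of the outer face. -/
def IsOuterplanar {V : Type*} [Finite V] (G : SimpleGraph V) : Prop :=
  ∃ D : PlaneDrawing G, ∀ v, D.point v ∈ frontier D.outerFace

/-! ### Spectral radius and extremal graphs -/

open Classical in
/-- The (real) adjacency matrix. -/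
noncomputable def adjacency {V : Type*} (G : SimpleGraph V) : Matrix V V ℝ :=
  G.adjMatrix ℝ

/-- The spectral radius `ρ(G)`: the largest modulus of an eigenvalue of the adjacency matrix (whose
eigenvalues are all real, as it is symmetric). -/
noncomputable def rho {V : Type*} [Fintype V] [DecidableEq V] (G : SimpleGraph V) : ℝ :=
  (spectralRadius ℝ (adjacency G)).toReal

/-- `spex_OP(n, F)`: the largest spectral radius of an `F`-free outerplanar graph with `n`
vertices. (The supremum is over a finite set.) -/
noncomputable def spexOP {W : Type*} (n : ℕ) (F : SimpleGraph W) : ℝ :=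
  sSup {r : ℝ | ∃ H : SimpleGraph (Fin n), IsOuterplanar H ∧ F.Free H ∧ r = rho H}

/-- `G` is an extremal graph for `spex_OP(n, F)`. -/
def IsExtremalOP {W : Type*} {n : ℕ} (F : SimpleGraph W) (G : SimpleGraph (Fin n)) : Prop :=
  IsOuterplanar G ∧ F.Free G ∧ rho G = spexOP n F

end Spex

/-!
Write `L` for the set of neighbours of the vertex `u` with `X u = 1`, and `B` for the set of
the remaining vertices other than `u`. The proof shows `B = ∅` by comparing `G` with the graph
`dominate G u`, in which all edges at `B` are deleted and each vertex of `B` is joined to `u`.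

*Topology.* All consequences of outerplanarity come from a parity argument, without the Jordan curve
theorem. For disjoint curves `γ`, `δ` the function `δ t - γ s` has a continuous logarithm, which
gives a linear relation between the winding numbers of each curve around the end points of the other
one. Adding these relations over all pairs of independent edges of `K_{3,3}` or `K_5` gives a
contradiction modulo `4`. Hence these graphs have no drawing in which independent edges are disjoint,
even if adjacent edges may meet (`not_drawing_K33`, `not_drawing_K5`). Given an outerplanar drawing,
a point `o` of the outer face is joined to each vertex `v` by a path that avoids the drawing of
`G - v` (`PlaneDrawing.exists_apex`): a small disc around `v` meets the outer face, and the path may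
cross the edges at `v`, since these are adjacent to the edge `o v`. With `o` as a new vertex,
`K_{2,3}` and `K_4` configurations in `G` would become drawings of `K_{3,3}` and `K_5`
(`IsOuterplanar.not_K23`, `IsOuterplanar.not_K4`).

*Structure.* In a connected outerplanar graph a vertex `v` has at most two neighbours at each given
distance from `u`, as long as this distance is at most that of `v` (`IsOuterplanar.card_le_two`).
So two vertices have at most two common neighbours, there are at most `3 n` edges, and every edge
can be charged to its end point farther from `u` such that no vertex pays for more than four edges.
The graph induced by `L` has maximum degree two and no cycles, so it is a disjoint union of paths
(`IsOuterplanar.isDisjointUnionOfPaths`). Therefore `dominate G u` has an explicit straight-line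
drawing (`isOuterplanar_of_label`). It is `F`-free as soon as `|V(F)| ≤ |L|` (`free_dominate`).

*Spectrum.* The star with `n` vertices is outerplanar and `F`-free, so `ρ ^ 2 ≥ n - 1`. As
`∑ X ≤ 6 n / ρ`, counting walks of length two (`sq_mul_le`) gives `|L| ≥ n - 1 - 13 √n` and, for
`v ≠ u`, a degree of order `√n` and `X v ≤ 1 / 5`. If `B` were not empty, then passing to
`dominate G u` would gain `X b * X u = X b` for each `b ∈ B`, and lose at most `X b * (4 / 5)`
(`sum_sum_lt_dominate`), so that `dominate G u` would have a larger spectral radius than `G`.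
-/

namespace Spex

/-! ### Turning numbers and the nonplanarity of `K_{3,3}` and `K_5` -/

/-- A continuous nowhere vanishing function on a real vector space has a continuous logarithm. -/
lemma exists_continuous_exp_eq {A : Type*} [NormedAddCommGroup A] [NormedSpace ℝ A] {f : A → ℂ}
    (hf : Continuous f) (h0 : ∀ x, f x ≠ 0) :
    ∃ g : A → ℂ, Continuous g ∧ ∀ x, Complex.exp (g x) = f x := by
  obtain ⟨F, ⟨-, hF⟩, -⟩ := Complex.isCoveringMapOn_exp.existsUnique_continuousMap_lifts
    (a₀ := (0 : A)) ⟨f, hf⟩ (Complex.exp_log (h0 0)) (fun x => h0 x)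
  exact ⟨F, F.continuous, fun x => congrFun hF x⟩

lemma sub_eq_sub_of_exp_eq {g h : ℝ → ℂ} (hg : Continuous g) (hh : Continuous h)
    (he : ∀ s, Complex.exp (g s) = Complex.exp (h s)) : g 1 - g 0 = h 1 - h 0 := by
  have hc : Continuous fun s => Complex.exp (g s) := by fun_prop
  obtain ⟨F, -, hu⟩ := Complex.isCoveringMapOn_exp.existsUnique_continuousMap_lifts
    (a₀ := (0 : ℝ)) (e₀ := g 0) ⟨fun s => Complex.exp (g s), hc⟩ rfl
    (fun s => Complex.exp_ne_zero _)
  have h1 := hu ⟨g, hg⟩ ⟨rfl, rfl⟩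
  have h2 := hu ⟨fun s => h s + (g 0 - h 0), by fun_prop⟩ ⟨by simp, by
    ext s
    simp [Complex.exp_add, Complex.exp_sub, he]⟩
  have h3 : g 1 = h 1 + (g 0 - h 0) := by
    simpa using congrArg (fun F : C(ℝ, ℂ) => F 1) (h1.trans h2.symm)
  rw [h3]
  ring

open Classical in
/-- The turn of the curve `γ` around the point `z`: the change of a continuous logarithm of `γ - z`
between the times `0` and `1` (zero if there is no such logarithm). -/
noncomputable def turn (z : ℂ) (γ : ℝ → ℂ) : ℂ :=
  if h : ∃ g : ℝ → ℂ, Continuous g ∧ ∀ s, Complex.exp (g s) = γ s - z then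
    h.choose 1 - h.choose 0
  else 0

lemma turn_eq {z : ℂ} {γ g : ℝ → ℂ} (hg : Continuous g)
    (h : ∀ s, Complex.exp (g s) = γ s - z) : turn z γ = g 1 - g 0 := by
  have hex : ∃ g : ℝ → ℂ, Continuous g ∧ ∀ s, Complex.exp (g s) = γ s - z := ⟨g, hg, h⟩
  rw [turn, dif_pos hex]
  refine sub_eq_sub_of_exp_eq hex.choose_spec.1 hg fun s => ?_
  rw [hex.choose_spec.2, h]

lemma turn_eq_of_neg {z : ℂ} {γ g : ℝ → ℂ} (hg : Continuous g)
    (h : ∀ s, Complex.exp (g s) = z - γ s) : turn z γ = g 1 - g 0 := by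
  rw [turn_eq (g := fun s => g s + Real.pi * Complex.I) (by fun_prop)
    (fun s => by rw [Complex.exp_add, h, Complex.exp_pi_mul_I]; ring)]
  ring

/-- The turn around `z` of a curve from `p` to `q` is known up to a multiple of `2 * π * I`. -/
lemma exists_turn_eq {z p q : ℂ} {γ : ℝ → ℂ} (hγ : Continuous γ) (hz : ∀ s, γ s ≠ z)
    (h0 : γ 0 = p) (h1 : γ 1 = q) : ∃ n : ℤ, turn z γ =
      Complex.log (q - z) - Complex.log (p - z) + n * (2 * Real.pi * Complex.I) := by
  obtain ⟨g, hg, hge⟩ := exists_continuous_exp_eq (f := fun s => γ s - z) (by fun_prop)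
    (fun s => sub_ne_zero.2 (hz s))
  have hp : p - z ≠ 0 := h0 ▸ sub_ne_zero.2 (hz 0)
  have hq : q - z ≠ 0 := h1 ▸ sub_ne_zero.2 (hz 1)
  obtain ⟨m, hm⟩ := Complex.exp_eq_exp_iff_exists_int.1
    (show Complex.exp (g 0) = Complex.exp (Complex.log (p - z)) by
      rw [hge, Complex.exp_log hp, h0])
  obtain ⟨k, hk⟩ := Complex.exp_eq_exp_iff_exists_int.1
    (show Complex.exp (g 1) = Complex.exp (Complex.log (q - z)) by
      rw [hge, Complex.exp_log hq, h1])
  refine ⟨k - m, ?_⟩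
  rw [turn_eq hg hge, hm, hk]
  push_cast
  ring

/-- The turns of two disjoint curves around the end points of each other cancel, because
`γ s` and `δ t` never meet, so that `δ t - γ s` has a logarithm on the whole parameter plane. -/
lemma turn_add_turn {γ δ : ℝ → ℂ} (hγ : Continuous γ) (hδ : Continuous δ)
    (h : ∀ s t, δ t ≠ γ s) :
    turn (γ 0) δ + turn (δ 1) γ = turn (γ 1) δ + turn (δ 0) γ := by
  obtain ⟨L, hL, hLe⟩ := exists_continuous_exp_eq (A := ℝ × ℝ) (f := fun x => δ x.2 - γ x.1)
    (by fun_prop) (fun x => sub_ne_zero.2 (h _ _))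
  have h0 : turn (γ 0) δ = L (0, 1) - L (0, 0) :=
    turn_eq (g := fun t => L (0, t)) (by fun_prop) fun t => hLe (0, t)
  have h1 : turn (γ 1) δ = L (1, 1) - L (1, 0) :=
    turn_eq (g := fun t => L (1, t)) (by fun_prop) fun t => hLe (1, t)
  have h2 : turn (δ 0) γ = L (1, 0) - L (0, 0) :=
    turn_eq_of_neg (g := fun s => L (s, 0)) (by fun_prop) fun s => hLe (s, 0)
  have h3 : turn (δ 1) γ = L (1, 1) - L (0, 1) :=
    turn_eq_of_neg (g := fun s => L (s, 1)) (by fun_prop) fun s => hLe (s, 1)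
  rw [h0, h1, h2, h3]
  ring

lemma exists_log_neg (z : ℂ) (hz : z ≠ 0) : ∃ k : ℤ, Odd k ∧
    Complex.log z - Complex.log (-z) = k * (Real.pi * Complex.I) := by
  obtain ⟨k, hk⟩ := Complex.exp_eq_exp_iff_exists_int.1
    (show Complex.exp (Complex.log z) = Complex.exp (Complex.log (-z) + Real.pi * Complex.I) by
      rw [Complex.exp_add, Complex.exp_log hz, Complex.exp_log (neg_ne_zero.2 hz),
        Complex.exp_pi_mul_I]; ring)
  refine ⟨2 * k + 1, ⟨k, rfl⟩, ?_⟩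
  rw [hk]
  push_cast
  ring

/-- Curves between distinct points of the plane give a system of integers: `n v a b` is the winding
of the curve from `P a` to `P b` around `P v`, and the odd number `m a b` compares the logarithms of
`P b - P a` and `P a - P b`. Each pair of disjoint curves gives one linear relation. -/
lemma exists_winding_system {ι : Type*} (P : ι → ℂ) (hP : Function.Injective P)
    (E : ι → ι → Set ℂ) : ∃ (m : ι → ι → ℤ) (n : ι → ι → ι → ℤ),
      (∀ a b, a ≠ b → Odd (m a b)) ∧ (∀ a b, a ≠ b → m b a = - m a b) ∧
      ∀ a b c d, JoinedIn (E a b) (P a) (P b) → JoinedIn (E c d) (P c) (P d) →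
        Disjoint (E a b) (E c d) →
        m a d + m c a + m d b + m b c
          + 2 * (n a c d + n d a b - n b c d - n c a b) = 0 := by
  classical
  have key : ∀ a b, ∃ γ : ℝ → ℂ, JoinedIn (E a b) (P a) (P b) →
      Continuous γ ∧ γ 0 = P a ∧ γ 1 = P b ∧ ∀ s, γ s ∈ E a b := by
    intro a b
    by_cases h : JoinedIn (E a b) (P a) (P b)
    · refine ⟨h.somePath.extend, fun _ => ⟨h.somePath.continuous_extend, by simp, by simp, ?_⟩⟩
      intro s
      have : h.somePath.extend s ∈ Set.range h.somePath := by
        rw [← Path.extend_range]; exact ⟨s, rfl⟩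
      obtain ⟨t, ht⟩ := this
      rw [← ht]
      exact h.somePath_mem t
    · exact ⟨fun _ => 0, fun h' => absurd h' h⟩
  choose γ hγ using key
  have hm : ∀ a b, ∃ k : ℤ, a ≠ b → Odd k ∧
      Complex.log (P b - P a) - Complex.log (P a - P b) = k * (Real.pi * Complex.I) := by
    intro a b
    by_cases h : a = b
    · exact ⟨0, fun h' => absurd h h'⟩
    · obtain ⟨k, hk, hk'⟩ := exists_log_neg (P b - P a) (sub_ne_zero.2 fun e => h (hP e).symm)
      exact ⟨k, fun _ => ⟨hk, by rw [← hk', neg_sub]⟩⟩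
  choose m hm using hm
  have hn : ∀ v a b, ∃ k : ℤ, JoinedIn (E a b) (P a) (P b) → P v ∉ E a b →
      turn (P v) (γ a b) = Complex.log (P b - P v) - Complex.log (P a - P v)
        + k * (2 * Real.pi * Complex.I) := by
    intro v a b
    by_cases h : JoinedIn (E a b) (P a) (P b) ∧ P v ∉ E a b
    · obtain ⟨h1, h2, h3, h4⟩ := hγ a b h.1
      obtain ⟨k, hk⟩ := exists_turn_eq (z := P v) h1 (fun s e => h.2 (by rw [← e]; exact h4 s)) h2 h3
      exact ⟨k, fun _ _ => hk⟩
    · exact ⟨0, fun h1 h2 => absurd ⟨h1, h2⟩ h⟩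
  choose n hn using hn
  have hpi : (Real.pi : ℂ) * Complex.I ≠ 0 :=
    mul_ne_zero (by exact_mod_cast Real.pi_ne_zero) Complex.I_ne_zero
  refine ⟨m, n, fun a b h => (hm a b h).1, ?_, ?_⟩
  · intro a b h
    have h1 := (hm a b h).2
    have h2 := (hm b a h.symm).2
    have : ((m b a : ℤ) : ℂ) * (Real.pi * Complex.I)
        = ((- m a b : ℤ) : ℂ) * (Real.pi * Complex.I) := by
      push_cast
      linear_combination -h1 - h2
    exact_mod_cast mul_right_cancel₀ hpi this
  · intro a b c d hab hcd hdis
    have ha : P a ∉ E c d := fun h => Set.disjoint_left.1 hdis hab.source_mem h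
    have hb : P b ∉ E c d := fun h => Set.disjoint_left.1 hdis hab.target_mem h
    have hc : P c ∉ E a b := fun h => Set.disjoint_left.1 hdis h hcd.source_mem
    have hd : P d ∉ E a b := fun h => Set.disjoint_left.1 hdis h hcd.target_mem
    have had : a ≠ d := fun e => hd (e ▸ hab.source_mem)
    have hca : c ≠ a := fun e => hc (e ▸ hab.source_mem)
    have hdb : d ≠ b := fun e => hd (e ▸ hab.target_mem)
    have hbc : b ≠ c := fun e => hc (e ▸ hab.target_mem)
    obtain ⟨c1, s1, t1, m1⟩ := hγ a b hab
    obtain ⟨c2, s2, t2, m2⟩ := hγ c d hcd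
    have h := turn_add_turn c1 c2
      (fun s t e => Set.disjoint_left.1 hdis (m1 s) (e ▸ m2 t))
    rw [s1, s2, t1, t2, hn a c d hcd ha, hn d a b hab hd, hn b c d hcd hb, hn c a b hab hc] at h
    have e1 := (hm a d had).2
    have e2 := (hm c a hca).2
    have e3 := (hm d b hdb).2
    have e4 := (hm b c hbc).2
    have : ((m a d + m c a + m d b + m b c
          + 2 * (n a c d + n d a b - n b c d - n c a b) : ℤ) : ℂ) * (Real.pi * Complex.I)
          = ((0 : ℤ) : ℂ) * (Real.pi * Complex.I) := by
      push_cast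
      linear_combination h - e1 - e2 - e3 - e4
    exact_mod_cast mul_right_cancel₀ hpi this

/-- `K_{3,3}` cannot be drawn so that all pairs of independent edges are disjoint; adjacent edges
may meet arbitrarily. -/
lemma not_drawing_K33 (A B : Fin 3 → ℂ) (hA : Function.Injective A) (hB : Function.Injective B)
    (hAB : ∀ i j, A i ≠ B j) (E : Fin 3 → Fin 3 → Set ℂ)
    (hE : ∀ i j, JoinedIn (E i j) (A i) (B j))
    (hd : ∀ i k j l, i < k → j ≠ l → Disjoint (E i j) (E k l)) : False := by
  obtain ⟨m, n, hodd, hanti, hrel⟩ := exists_winding_system (Sum.elim A B)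
    (hA.sumElim hB hAB) (fun x y => Sum.elim (fun i => Sum.elim (fun _ => ∅) (E i) y)
      (fun _ => ∅) x)
  obtain ⟨α, hαd⟩ : ∃ α : Fin 3 → Fin 3 → ℤ, ∀ i k, m (.inl i) (.inl k) = α i k :=
    ⟨_, fun _ _ => rfl⟩
  obtain ⟨β, hβd⟩ : ∃ β : Fin 3 → Fin 3 → ℤ, ∀ j l, m (.inr j) (.inr l) = β j l :=
    ⟨_, fun _ _ => rfl⟩
  obtain ⟨μ, hμd⟩ : ∃ μ : Fin 3 → Fin 3 → ℤ, ∀ i j, m (.inl i) (.inr j) = μ i j :=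
    ⟨_, fun _ _ => rfl⟩
  obtain ⟨p, hpd⟩ : ∃ p : Fin 3 → Fin 3 → Fin 3 → ℤ,
      ∀ i k l, n (.inl i) (.inl k) (.inr l) = p i k l := ⟨_, fun _ _ _ => rfl⟩
  obtain ⟨q, hqd⟩ : ∃ q : Fin 3 → Fin 3 → Fin 3 → ℤ,
      ∀ j k l, n (.inr j) (.inl k) (.inr l) = q j k l := ⟨_, fun _ _ _ => rfl⟩
  have hα : ∀ i k, i ≠ k → α k i = - α i k := fun i k h => by
    simpa only [hαd] using hanti (.inl i) (.inl k) (by simpa using h)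
  have hβ : ∀ i k, i ≠ k → β k i = - β i k := fun i k h => by
    simpa only [hβd] using hanti (.inr i) (.inr k) (by simpa using h)
  have oα : ∀ i k, i ≠ k → Odd (α i k) := fun i k h => by
    simpa only [hαd] using hodd (.inl i) (.inl k) (by simpa using h)
  have key : ∀ i k j l, i < k → j ≠ l →
      μ i l + α k i + β l j - μ k j + 2 * (p i k l + q l i j - q j k l - p k i j) = 0 := by
    intro i k j l hik hjl
    have h := hrel (.inl i) (.inr j) (.inl k) (.inr l) (hE i j) (hE k l) (hd i k j l hik hjl)
    have h' := hanti (.inl k) (.inr j) (by simp)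
    simp only [hαd, hβd, hμd, hpd, hqd] at h h'
    linear_combination h - h'
  have e1 := key 0 1 0 1 (by decide) (by decide)
  have e2 := key 0 1 0 2 (by decide) (by decide)
  have e3 := key 0 1 1 0 (by decide) (by decide)
  have e4 := key 0 1 1 2 (by decide) (by decide)
  have e5 := key 0 1 2 0 (by decide) (by decide)
  have e6 := key 0 1 2 1 (by decide) (by decide)
  have e7 := key 0 2 0 1 (by decide) (by decide)
  have e8 := key 0 2 0 2 (by decide) (by decide)
  have e9 := key 0 2 1 0 (by decide) (by decide)
  have e10 := key 0 2 1 2 (by decide) (by decide)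
  have e11 := key 0 2 2 0 (by decide) (by decide)
  have e12 := key 0 2 2 1 (by decide) (by decide)
  have e13 := key 1 2 0 1 (by decide) (by decide)
  have e14 := key 1 2 0 2 (by decide) (by decide)
  have e15 := key 1 2 1 0 (by decide) (by decide)
  have e16 := key 1 2 1 2 (by decide) (by decide)
  have e17 := key 1 2 2 0 (by decide) (by decide)
  have e18 := key 1 2 2 1 (by decide) (by decide)
  have sa01 := hα 0 1 (by decide)
  have sb01 := hβ 0 1 (by decide)
  have sb02 := hβ 0 2 (by decide)
  have sb12 := hβ 1 2 (by decide)
  have sa02 := hα 0 2 (by decide)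
  have sa12 := hα 1 2 (by decide)
  obtain ⟨ka01, ha01⟩ := oα 0 1 (by decide)
  obtain ⟨ka02, ha02⟩ := oα 0 2 (by decide)
  obtain ⟨ka12, ha12⟩ := oα 1 2 (by decide)
  -- Modulo `4`, the sum of the eighteen relations is `6 * (α 1 0 + α 2 0 + α 2 1)`.
  have hsum : 4 * (
      μ 0 1 + p 0 1 1 + q 1 0 0 - p 1 0 0 + μ 0 2 + p 0 1 2 + q 2 0 0 + μ 0 0 + p 0 1 0 + q 0 0 1
      - p 1 0 1 + q 2 0 1 + q 0 0 2 - p 1 0 2 + q 1 0 2 - μ 2 0 + p 0 2 1 - q 0 2 1 - p 2 0 0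
      + p 0 2 2 - q 0 2 2 - μ 2 1 + p 0 2 0 - q 1 2 0 - p 2 0 1 - q 1 2 2 - μ 2 2 - q 2 2 0
      - p 2 0 2 - q 2 2 1 + p 1 2 1 - p 2 1 0 + p 1 2 2 + p 1 2 0 - p 2 1 1 - p 2 1 2 - 3 * ka01
      - 3 * ka02 - 3 * ka12)
      - 18 = 0 := by
    linear_combination
      e1 + e2 + e3 + e4 + e5 + e6 + e7 + e8 + e9 + e10 + e11 + e12 + e13 + e14 + e15 + e16 + e17
      + e18 - 6 * sa01 - 3 * sb01 - 3 * sb02 - 3 * sb12 - 6 * sa02 - 6 * sa12 + 6 * ha01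
      + 6 * ha02 + 6 * ha12
  clear * - hsum
  omega

/-- `K_5` cannot be drawn so that all pairs of independent edges are disjoint. The vertices are `o`
and the four points `P i`. -/
lemma not_drawing_K5 (o : ℂ) (P : Fin 4 → ℂ) (hP : Function.Injective P) (ho : ∀ i, o ≠ P i)
    (T : Fin 4 → Set ℂ) (E : Fin 4 → Fin 4 → Set ℂ)
    (hT : ∀ i, JoinedIn (T i) o (P i)) (hE : ∀ i j, i < j → JoinedIn (E i j) (P i) (P j))
    (hTE : ∀ i k l, k < l → i ≠ k → i ≠ l → Disjoint (T i) (E k l))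
    (h01 : Disjoint (E 0 1) (E 2 3)) (h02 : Disjoint (E 0 2) (E 1 3))
    (h03 : Disjoint (E 0 3) (E 1 2)) : False := by
  obtain ⟨m', n', hodd, hanti, hrel⟩ := exists_winding_system (fun x : Option (Fin 4) => x.elim o P)
    (fun x y h => by
      cases x <;> cases y
      · rfl
      · exact absurd h (ho _)
      · exact absurd h.symm (ho _)
      · exact congrArg some (hP h))
    (fun x y => x.elim (y.elim ∅ T) fun i => y.elim ∅ (E i))
  obtain ⟨m, hmd⟩ : ∃ m : Fin 4 → Fin 4 → ℤ, ∀ i k, m' (some i) (some k) = m i k :=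
    ⟨_, fun _ _ => rfl⟩
  obtain ⟨g, hgd⟩ : ∃ g : Fin 4 → ℤ, ∀ i, m' none (some i) = g i := ⟨_, fun _ => rfl⟩
  obtain ⟨n, hnd⟩ : ∃ n : Fin 4 → Fin 4 → Fin 4 → ℤ,
      ∀ i k l, n' (some i) (some k) (some l) = n i k l := ⟨_, fun _ _ _ => rfl⟩
  obtain ⟨r, hrd⟩ : ∃ r : Fin 4 → Fin 4 → ℤ, ∀ k l, n' none (some k) (some l) = r k l :=
    ⟨_, fun _ _ => rfl⟩
  obtain ⟨p, hpd⟩ : ∃ p : Fin 4 → Fin 4 → ℤ, ∀ k l, n' (some k) none (some l) = p k l :=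
    ⟨_, fun _ _ => rfl⟩
  have hm : ∀ i k, i ≠ k → m k i = - m i k := fun i k h => by
    simpa only [hmd] using hanti (some i) (some k) (by simpa using h)
  have om : ∀ i k, i ≠ k → Odd (m i k) := fun i k h => by
    simpa only [hmd] using hodd (some i) (some k) (by simpa using h)
  have og : ∀ i, Odd (g i) := fun i => by
    simpa only [hgd] using hodd none (some i) (by simp)
  have key₁ : ∀ i k l, k < l → i ≠ k → i ≠ l →
      g l - g k + m l i + m i k + 2 * (r k l + p l i - n i k l - p k i) = 0 := by
    intro i k l hkl hik hil
    have h := hrel none (some i) (some k) (some l) (hT i) (hE k l hkl) (hTE i k l hkl hik hil)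
    have h' := hanti none (some k) (by simp)
    simp only [hmd, hgd, hnd, hrd, hpd] at h h'
    linear_combination h - h'
  have key₂ : ∀ a b c d, a < b → c < d → Disjoint (E a b) (E c d) →
      m a d + m c a + m d b + m b c + 2 * (n a c d + n d a b - n b c d - n c a b) = 0 := by
    intro a b c d hab hcd hdis
    have h := hrel (some a) (some b) (some c) (some d) (hE a b hab) (hE c d hcd) hdis
    simpa only [hmd, hnd] using h
  have e1 := key₁ 2 0 1 (by decide) (by decide) (by decide)
  have e2 := key₁ 3 0 1 (by decide) (by decide) (by decide)
  have e3 := key₁ 1 0 2 (by decide) (by decide) (by decide)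
  have e4 := key₁ 3 0 2 (by decide) (by decide) (by decide)
  have e5 := key₁ 1 0 3 (by decide) (by decide) (by decide)
  have e6 := key₁ 2 0 3 (by decide) (by decide) (by decide)
  have e7 := key₁ 0 1 2 (by decide) (by decide) (by decide)
  have e8 := key₁ 3 1 2 (by decide) (by decide) (by decide)
  have e9 := key₁ 0 1 3 (by decide) (by decide) (by decide)
  have e10 := key₁ 2 1 3 (by decide) (by decide) (by decide)
  have e11 := key₁ 0 2 3 (by decide) (by decide) (by decide)
  have e12 := key₁ 1 2 3 (by decide) (by decide) (by decide)
  have e13 := key₂ 0 1 2 3 (by decide) (by decide) h01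
  have e14 := key₂ 0 2 1 3 (by decide) (by decide) h02
  have e15 := key₂ 0 3 1 2 (by decide) (by decide) h03
  have sm02 := hm 0 2 (by decide)
  have sm03 := hm 0 3 (by decide)
  have sm12 := hm 1 2 (by decide)
  have sm01 := hm 0 1 (by decide)
  have sm13 := hm 1 3 (by decide)
  have sm23 := hm 2 3 (by decide)
  obtain ⟨kg1, hg1⟩ := og 1
  obtain ⟨kg0, hg0⟩ := og 0
  obtain ⟨kg2, hg2⟩ := og 2
  obtain ⟨kg3, hg3⟩ := og 3
  obtain ⟨km01, hm01⟩ := om 0 1 (by decide)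
  obtain ⟨km02, hm02⟩ := om 0 2 (by decide)
  obtain ⟨km03, hm03⟩ := om 0 3 (by decide)
  -- Again the winding numbers drop out modulo `4`, and what is left is `2` modulo `4`.
  have hsum : 4 * (
      -kg1 - 3 * kg0 + r 0 1 - n 2 0 1 - p 0 2 - m 1 3 - p 0 3 + kg2 + r 0 2 - n 1 0 2 - p 0 1
      + p 2 3 + 3 * kg3 + r 0 3 + p 3 1 - n 1 0 3 + p 3 2 - km01 + r 1 2 - p 1 0 - n 3 1 2 + r 1 3
      + p 3 0 - n 2 1 3 - km02 + r 2 3 - n 1 2 3 - km03)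
      - 6 = 0 := by
    linear_combination
      e1 + e2 + e3 + e4 + e5 + e6 + e7 + e8 + e9 + e10 + e11 + e12 + e13 + e14 + e15 - 4 * sm02
      - 4 * sm03 - 3 * sm12 - 4 * sm01 - 5 * sm13 - 3 * sm23 + 2 * hg1 + 6 * hg0 - 2 * hg2
      - 6 * hg3 + 2 * hm01 + 2 * hm02 + 2 * hm03
  clear * - hsum
  omega

section

/-! ### The apex of an outerplanar drawing -/

/-- Complex coordinates on the plane. -/
noncomputable def planeToComplex : Plane ≃ₗᵢ[ℝ] ℂ := Complex.orthonormalBasisOneI.repr.symm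

variable {V : Type*} {G : SimpleGraph V}

lemma IsArc.joinedIn {A : Set Plane} {p q : Plane} (h : IsArc A p q) : JoinedIn A p q := by
  obtain ⟨γ, -, hγ⟩ := h
  exact ⟨γ, fun t => hγ ▸ ⟨t, rfl⟩⟩

lemma IsArc.isCompact {A : Set Plane} {p q : Plane} (h : IsArc A p q) : IsCompact A := by
  obtain ⟨γ, -, hγ⟩ := h
  exact hγ ▸ isCompact_range γ.continuous

namespace PlaneDrawing

variable (D : PlaneDrawing G)

/-- The part of the drawing that represents the subgraph induced by `S`. -/
def trace (S : Set V) : Set Plane :=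
  {z | (∃ v ∈ S, z = D.point v) ∨ ∃ e : G.edgeSet, (∀ v ∈ (e : Sym2 V), v ∈ S) ∧ z ∈ D.arc e}

/-- The complement of the drawing of `G - v`. It is a neighbourhood of the point that represents
`v`, and it may contain parts of the edges at `v`. -/
def away (v : V) : Set Plane := (D.trace {v}ᶜ)ᶜ

variable {D}

lemma isCompact_arc (e : G.edgeSet) : IsCompact (D.arc e) := by
  obtain ⟨e, he⟩ := e
  induction e using Sym2.ind with
  | _ u v => exact (D.isArc u v he).isCompact

lemma trace_mono {S T : Set V} (h : S ⊆ T) : D.trace S ⊆ D.trace T := by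
  rintro z (⟨v, hv, rfl⟩ | ⟨e, he, hz⟩)
  · exact Or.inl ⟨v, h hv, rfl⟩
  · exact Or.inr ⟨e, fun v hv => h (he v hv), hz⟩

lemma support_eq : D.support = D.trace Set.univ := by
  ext z
  simp [support, trace, eq_comm]

lemma isCompact_trace [Finite V] (S : Set V) : IsCompact (D.trace S) := by
  have : D.trace S = (⋃ v ∈ S, {D.point v}) ∪
      ⋃ e ∈ {e : G.edgeSet | ∀ v ∈ (e : Sym2 V), v ∈ S}, D.arc e := by
    ext z
    simp [trace]
  rw [this]
  exact (S.toFinite.isCompact_biUnion fun _ _ => isCompact_singleton).union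
    ((Set.toFinite _).isCompact_biUnion fun e _ => isCompact_arc e)

lemma disjoint_trace {S T : Set V} (h : Disjoint S T) : Disjoint (D.trace S) (D.trace T) := by
  rw [Set.disjoint_left] at h ⊢
  rintro z (⟨v, hv, rfl⟩ | ⟨e, he, hz⟩) (⟨w, hw, hvw⟩ | ⟨f, hf, hz'⟩)
  · exact h hv (D.point_injective hvw ▸ hw)
  · exact h hv (hf v (D.mem_of_point_mem_arc v f hz'))
  · subst hvw
    exact h (he w (D.mem_of_point_mem_arc w e hz)) hw
  · by_cases hef : e = f
    · subst hef
      obtain ⟨v, hv⟩ : ∃ v, v ∈ (e : Sym2 V) := ⟨_, Sym2.out_fst_mem _⟩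
      exact h (he v hv) (hf v hv)
    · obtain ⟨v, rfl⟩ := D.arc_inter_subset e f hef ⟨hz, hz'⟩
      exact h (he v (D.mem_of_point_mem_arc v e hz)) (hf v (D.mem_of_point_mem_arc v f hz'))

lemma disjoint_away_trace {v : V} {S : Set V} (h : v ∉ S) : Disjoint (D.away v) (D.trace S) :=
  Set.disjoint_compl_left_iff_subset.2
    (trace_mono fun _ hx e => h (by rwa [Set.mem_singleton_iff.1 e] at hx))

lemma joinedIn_trace {S : Set V} {u v : V} (w : G.Walk u v) (hw : ∀ x ∈ w.support, x ∈ S) :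
    JoinedIn (D.trace S) (D.point u) (D.point v) := by
  induction w with
  | nil => exact JoinedIn.refl (Or.inl ⟨_, hw _ (by simp), rfl⟩)
  | @cons a b c h p ih =>
    have hb : b ∈ S := hw b (by simp)
    refine (((D.isArc a b h).joinedIn).mono fun z hz => ?_).trans
      (ih fun x hx => hw x (by simp [hx]))
    refine Or.inr ⟨⟨s(a, b), h⟩, fun x hx => ?_, hz⟩
    rcases Sym2.mem_iff.1 hx with rfl | rfl
    · exact hw _ (by simp)
    · exact hb

lemma joinedIn_of_le_norm {R : ℝ} (hR : 0 < R) {z w : Plane} (hz : R ≤ ‖z‖) (hw : R ≤ ‖w‖) :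
    JoinedIn (Metric.ball (0 : Plane) R)ᶜ z w := by
  have radial : ∀ x : Plane, R ≤ ‖x‖ → ∃ y ∈ Metric.sphere (0 : Plane) R,
      JoinedIn (Metric.ball (0 : Plane) R)ᶜ x y := by
    intro x hx
    have hx0 : 0 < ‖x‖ := hR.trans_le hx
    refine ⟨(R / ‖x‖) • x, ?_, JoinedIn.of_segment_subset ?_⟩
    · simp [norm_smul, abs_of_pos hR, hx0.ne']
    · rintro _ ⟨a, b, ha, hb, hab, rfl⟩
      have : a • x + b • (R / ‖x‖) • x = (a + b * (R / ‖x‖)) • x := by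
        rw [add_smul, smul_smul]
      have h1 : 0 ≤ a + b * (R / ‖x‖) := by positivity
      simp only [Set.mem_compl_iff, Metric.mem_ball, dist_zero_right, not_lt, this, norm_smul,
        Real.norm_eq_abs, abs_of_nonneg h1]
      have h2 : (a + b * (R / ‖x‖)) * ‖x‖ = a * ‖x‖ + b * R := by
        field_simp
      rw [h2]
      calc R = a * R + b * R := by rw [← add_mul, hab, one_mul]
        _ ≤ a * ‖x‖ + b * R := by gcongr
  obtain ⟨z', hz', hzz'⟩ := radial z hz
  obtain ⟨w', hw', hww'⟩ := radial w hw
  have hsph : IsPathConnected (Metric.sphere (0 : Plane) R) :=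
    isPathConnected_sphere (Module.lt_rank_of_lt_finrank (by simp)) 0 hR.le
  refine (hzz'.trans ((hsph.joinedIn z' hz' w' hw').mono fun x hx => ?_)).trans hww'.symm
  simp only [Metric.mem_sphere, dist_zero_right] at hx
  simp [hx]

/-- Any two points of the outer face are joined by a path in the complement of the drawing. -/
lemma joinedIn_outerFace [Finite V] {p q : Plane} (hp : p ∈ D.outerFace) (hq : q ∈ D.outerFace) :
    JoinedIn D.supportᶜ p q := by
  have hc : IsCompact D.support := support_eq (D := D) ▸ isCompact_trace _
  have ho : IsOpen D.supportᶜ := hc.isClosed.isOpen_compl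
  obtain ⟨R, hR, hsub⟩ : ∃ R, 0 < R ∧ D.support ⊆ Metric.ball 0 R := by
    obtain ⟨R, hR⟩ := hc.isBounded.subset_ball (0 : Plane)
    exact ⟨max R 1, by positivity, hR.trans (Metric.ball_subset_ball (le_max_left _ _))⟩
  have far : ∀ x ∈ D.outerFace, ∃ z, R ≤ ‖z‖ ∧ JoinedIn D.supportᶜ x z := by
    rintro x ⟨hx, hub⟩
    obtain ⟨z, hz, hzR⟩ : ∃ z ∈ connectedComponentIn D.supportᶜ x, R ≤ ‖z‖ := by
      by_contra! h
      have hsub' : connectedComponentIn D.supportᶜ x ⊆ Metric.ball 0 R := fun z hz =>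
        mem_ball_zero_iff.2 (h z hz)
      exact hub (Metric.isBounded_ball.subset hsub')
    have hpc : IsPathConnected (connectedComponentIn D.supportᶜ x) :=
      ho.connectedComponentIn.isConnected_iff_isPathConnected.1
        (isConnected_connectedComponentIn_iff.2 hx)
    exact ⟨z, hzR, (hpc.joinedIn x (mem_connectedComponentIn hx) z hz).mono
      (connectedComponentIn_subset _ _)⟩
  obtain ⟨z, hz, hpz⟩ := far p hp
  obtain ⟨w, hw, hqw⟩ := far q hq
  exact (hpz.trans ((joinedIn_of_le_norm hR hz hw).mono (Set.compl_subset_compl.2 hsub))).trans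
    hqw.symm

/-- If all vertices lie on the boundary of the outer face, then a point of the outer face is joined
to each vertex by a path that avoids the drawing of the rest of the graph. This path may cross the
edges at the vertex, so that no accessibility of boundary points is needed. -/
lemma exists_apex [Finite V] (hD : ∀ v, D.point v ∈ frontier D.outerFace) :
    ∃ o, (∀ v, o ≠ D.point v) ∧ ∀ v, JoinedIn (D.away v) o (D.point v) := by
  have near : ∀ v, ∃ q ∈ D.outerFace, JoinedIn (D.away v) q (D.point v) := by
    intro v
    have hopen : IsOpen (D.away v) := (isCompact_trace _).isClosed.isOpen_compl
    have hmem : D.point v ∈ D.away v := by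
      have := disjoint_trace (D := D) (S := {v}) (T := {v}ᶜ) disjoint_compl_right
      exact fun h => Set.disjoint_left.1 this (Or.inl ⟨v, rfl, rfl⟩) h
    obtain ⟨ε, hε, hball⟩ := Metric.isOpen_iff.1 hopen _ hmem
    obtain ⟨q, hq, hqO⟩ := mem_closure_iff.1 (frontier_subset_closure (hD v))
      _ Metric.isOpen_ball (Metric.mem_ball_self hε)
    exact ⟨q, hqO, ((Metric.isPathConnected_ball hε).joinedIn _ hq _
      (Metric.mem_ball_self hε)).mono hball⟩
  cases isEmpty_or_nonempty V with
  | inl h => exact ⟨0, fun v => h.elim v, fun v => h.elim v⟩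
  | inr h =>
    obtain ⟨v₀⟩ := h
    obtain ⟨o, ho, -⟩ := near v₀
    refine ⟨o, fun v hv => ho.1 (Or.inl ⟨v, hv.symm⟩), fun v => ?_⟩
    obtain ⟨q, hq, hqv⟩ := near v
    refine ((joinedIn_outerFace ho hq).mono ?_).trans hqv
    rw [support_eq]
    exact Set.compl_subset_compl.2 (trace_mono (Set.subset_univ _))

end PlaneDrawing

/-! ### Forbidden configurations -/

/-- An outerplanar graph contains no subdivision of `K_{2,3}`: with the apex as a sixth vertex
this would be a drawing of `K_{3,3}`. The three walks at `a` may overlap, and so may those at `b`. -/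
lemma IsOuterplanar.not_K23 [Finite V] (hG : IsOuterplanar G) {a b : V} {p : Fin 3 → V}
    (w : ∀ i, G.Walk a (p i)) (w' : ∀ i, G.Walk b (p i))
    (hdis : ∀ i j, i ≠ j → List.Disjoint (w i).support (w' j).support)
    (hw : ∀ i j, i ≠ j → p j ∉ (w i).support) (hw' : ∀ i j, i ≠ j → p j ∉ (w' i).support) :
    False := by
  obtain ⟨D, hD⟩ := hG
  obtain ⟨o, ho, hT⟩ := D.exists_apex hD
  have hφ : Function.Injective planeToComplex := planeToComplex.injective
  have hφc : Continuous planeToComplex := planeToComplex.continuous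
  have hp : Function.Injective p := by
    intro i j h
    by_contra hij
    exact hw i j hij (h ▸ (w i).end_mem_support)
  have hab : a ≠ b := by
    rintro rfl
    exact hdis 0 1 (by decide) (w 0).start_mem_support (w' 1).start_mem_support
  have hne : ∀ j : Fin 3, ∃ i, i ≠ j := by decide
  have hap : ∀ j, a ≠ p j := fun j h => by
    obtain ⟨i, hi⟩ := hne j
    exact hw i j hi (h ▸ (w i).start_mem_support)
  have hbp : ∀ j, b ≠ p j := fun j h => by
    obtain ⟨i, hi⟩ := hne j
    exact hw' i j hi (h ▸ (w' i).start_mem_support)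
  have disj : ∀ {S T : Set V}, Disjoint S T →
      Disjoint (planeToComplex '' D.trace S) (planeToComplex '' D.trace T) := fun h =>
    (Set.disjoint_image_iff hφ).2 (PlaneDrawing.disjoint_trace h)
  have disj' : ∀ {v : V} {S : Set V}, v ∉ S →
      Disjoint (planeToComplex '' D.trace S) (planeToComplex '' D.away v) := fun h =>
    (Set.disjoint_image_iff hφ).2 (PlaneDrawing.disjoint_away_trace h).symm
  have pt : ∀ {x y : V}, x ≠ y → planeToComplex (D.point x) ≠ planeToComplex (D.point y) :=
    fun h e => h (D.point_injective (hφ e))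
  refine not_drawing_K33
    ![planeToComplex (D.point a), planeToComplex (D.point b), planeToComplex o]
    (fun j => planeToComplex (D.point (p j))) ?_ (fun i j h => hp (D.point_injective (hφ h))) ?_
    ![fun j => planeToComplex '' D.trace {x | x ∈ (w j).support},
      fun j => planeToComplex '' D.trace {x | x ∈ (w' j).support},
      fun j => planeToComplex '' D.away (p j)] ?_ ?_
  · have h1 := pt hab
    have h2 : planeToComplex o ≠ planeToComplex (D.point a) := fun e => ho a (hφ e)
    have h3 : planeToComplex o ≠ planeToComplex (D.point b) := fun e => ho b (hφ e)
    intro i j h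
    fin_cases i <;> fin_cases j <;> simp_all [eq_comm]
  · intro i j
    fin_cases i
    · exact pt (hap j)
    · exact pt (hbp j)
    · exact fun e => ho _ (hφ e)
  · intro i j
    fin_cases i
    · exact (PlaneDrawing.joinedIn_trace (w j) fun _ => id).map hφc
    · exact (PlaneDrawing.joinedIn_trace (w' j) fun _ => id).map hφc
    · exact (hT (p j)).map hφc
  · intro i k j l hik hjl
    fin_cases i <;> fin_cases k <;> first | exact absurd hik (by decide) | skip
    · exact disj (Set.disjoint_left.2 fun x hx hx' => hdis j l hjl hx hx')
    · exact disj' (hw j l hjl)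
    · exact disj' (hw' j l hjl)

/-- In an outerplanar graph, no vertex `u` is adjacent to three vertices `a`, `b`, `c` on a cycle
that avoids `u`: with the apex this would be a drawing of `K_5`. -/
lemma IsOuterplanar.not_K4 [Finite V] (hG : IsOuterplanar G) {u a b c : V} (hua : G.Adj u a)
    (hub : G.Adj u b) (huc : G.Adj u c) (hab : G.Adj a b) (hbc : G.Adj b c) (hac : a ≠ c)
    (w : G.Walk a c) (hwu : u ∉ w.support) (hwb : b ∉ w.support) : False := by
  obtain ⟨D, hD⟩ := hG
  obtain ⟨o, ho, hT⟩ := D.exists_apex hD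
  have hφ : Function.Injective planeToComplex := planeToComplex.injective
  have hφc : Continuous planeToComplex := planeToComplex.continuous
  have disj : ∀ {S T : Set V}, Disjoint S T →
      Disjoint (planeToComplex '' D.trace S) (planeToComplex '' D.trace T) := fun h =>
    (Set.disjoint_image_iff hφ).2 (PlaneDrawing.disjoint_trace h)
  have disj' : ∀ {v : V} {S : Set V}, v ∉ S →
      Disjoint (planeToComplex '' D.away v) (planeToComplex '' D.trace S) := fun h =>
    (Set.disjoint_image_iff hφ).2 (PlaneDrawing.disjoint_away_trace h)
  have joined : ∀ {x y : V}, G.Adj x y → JoinedIn (planeToComplex '' D.trace {x, y})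
      (planeToComplex (D.point x)) (planeToComplex (D.point y)) := fun h =>
    (PlaneDrawing.joinedIn_trace h.toWalk (by simp)).map hφc
  obtain ⟨P, hPdef⟩ : ∃ P : Fin 4 → V, P = ![u, a, b, c] := ⟨_, rfl⟩
  obtain ⟨S, hSdef⟩ : ∃ S : Fin 4 → Fin 4 → Set V, S = fun i j =>
    if i = 1 ∧ j = 3 then {x | x ∈ w.support} else {P i, P j} := ⟨_, rfl⟩
  have hPinj : Function.Injective P := by
    have := hua.ne; have := hub.ne; have := huc.ne; have := hab.ne; have := hbc.ne
    intro i j h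
    fin_cases i <;> fin_cases j <;> simp_all [eq_comm]
  have ha := w.start_mem_support
  have hc := w.end_mem_support
  refine not_drawing_K5 (planeToComplex o) (fun i => planeToComplex (D.point (P i)))
    (fun i j h => hPinj (D.point_injective (hφ h))) (fun i e => ho _ (hφ e))
    (fun i => planeToComplex '' D.away (P i)) (fun i j => planeToComplex '' D.trace (S i j))
    (fun i => (hT _).map hφc) ?_ ?_ (disj ?_) (disj ?_) (disj ?_)
  · intro i j hij
    by_cases h : i = 1 ∧ j = 3
    · obtain ⟨rfl, rfl⟩ := h
      subst hPdef hSdef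
      exact (PlaneDrawing.joinedIn_trace w fun _ => id).map hφc
    · simp only [hSdef, if_neg h]
      refine joined ?_
      subst hPdef
      fin_cases i <;> fin_cases j <;> first | exact absurd hij (by decide) | skip
      · exact hua
      · exact hub
      · exact huc
      · exact hab
      · exact absurd ⟨rfl, rfl⟩ h
      · exact hbc
  · intro i k l hkl hik hil
    refine disj' ?_
    by_cases h : k = 1 ∧ l = 3
    · obtain ⟨rfl, rfl⟩ := h
      subst hPdef hSdef
      fin_cases i
      · exact hwu
      · exact absurd rfl hik
      · exact hwb
      · exact absurd rfl hil
    · simp only [hSdef, if_neg h]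
      rintro (h' | h')
      · exact hik (hPinj h')
      · exact hil (hPinj h')
  · subst hPdef hSdef
    change Disjoint ({u, a} : Set V) {b, c}
    simp [hub.ne', huc.ne', hab.ne', hac.symm]
  · subst hPdef hSdef
    rw [Set.disjoint_left]
    rintro x (rfl | rfl) h
    · exact hwu h
    · exact hwb h
  · subst hPdef hSdef
    change Disjoint ({u, c} : Set V) {a, b}
    simp [hua.ne', hub.ne', hac, hbc.ne]

end

section

variable {V : Type*} {G : SimpleGraph V}

/-! ### Distance layers -/

lemma eq_or_dist_lt_of_mem_geodesic {u p x : V} (w : G.Walk u p) (hw : w.length = G.dist u p)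
    (hx : x ∈ w.support) : x = p ∨ G.dist u x < G.dist u p := by
  classical
  by_cases hxp : x = p
  · exact Or.inl hxp
  · right
    calc G.dist u x ≤ (w.takeUntil x hx).length := SimpleGraph.dist_le _
      _ < w.length := w.length_takeUntil_lt_length hx hxp
      _ = _ := hw

/-- A vertex `v` has at most two neighbours on each layer of vertices at a fixed distance from `u`,
unless that layer is farther from `u` than `v`. Three such neighbours would give a `K_{2,3}`
configuration with shortest paths to `u`. -/
lemma IsOuterplanar.card_le_two [Finite V] (hG : IsOuterplanar G) (hc : G.Connected) {u v : V}
    {k : ℕ} (hk : k ≤ G.dist u v) (S : Finset V)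
    (hS : ∀ w ∈ S, G.Adj v w ∧ G.dist u w = k) : S.card ≤ 2 := by
  by_contra! hcard
  obtain ⟨a, b, c, ha, hb, hc', hab, hac, hbc⟩ := Finset.two_lt_card_iff.1 hcard
  obtain ⟨p, hpS, hp⟩ : ∃ p : Fin 3 → V, (∀ i, p i ∈ S) ∧ Function.Injective p := by
    refine ⟨![a, b, c], fun i => ?_, fun i j h => ?_⟩
    · fin_cases i <;> assumption
    · fin_cases i <;> fin_cases j <;> simp_all [eq_comm]
  choose w hw using fun i => hc.exists_walk_length_eq_dist u (p i)
  have hadj i := (hS _ (hpS i)).1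
  have hdist i := (hS _ (hpS i)).2
  have mem : ∀ i x, x ∈ (w i).support → x = p i ∨ G.dist u x < k := fun i x hx => by
    have := eq_or_dist_lt_of_mem_geodesic (w i) (hw i) hx
    rwa [hdist] at this
  have hpw : ∀ i j, i ≠ j → p j ∉ (w i).support := fun i j hij h => by
    rcases mem i _ h with h | h
    · exact hij (hp h).symm
    · rw [hdist] at h
      exact lt_irrefl _ h
  refine hG.not_K23 (p := p) w (fun i => (hadj i).toWalk) (fun i j hij x hx hx' => ?_) hpw
    (fun i j hij h => ?_)
  · simp only [SimpleGraph.Walk.support_cons, SimpleGraph.Walk.support_nil, List.mem_cons,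
      List.not_mem_nil, or_false] at hx'
    rcases hx' with rfl | rfl
    · rcases mem i _ hx with h | h
      · exact (hadj i).ne h
      · omega
    · exact hpw i j hij hx
  · simp only [SimpleGraph.Walk.support_cons, SimpleGraph.Walk.support_nil, List.mem_cons,
      List.not_mem_nil, or_false] at h
    rcases h with h | h
    · exact (hadj j).ne h.symm
    · exact hij (hp h).symm

/-! ### Linear forests -/

section LinearForest

variable {H : SimpleGraph V}

lemma exists_walk_getVert {a b : V} (p : H.Walk a b) {i j : ℕ} (hij : i ≤ j) (hj : j ≤ p.length) :
    ∃ w : H.Walk (p.getVert i) (p.getVert j),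
      ∀ x ∈ w.support, ∃ k, i ≤ k ∧ k ≤ j ∧ x = p.getVert k := by
  induction j, hij using Nat.le_induction with
  | base => exact ⟨.nil, fun x hx => ⟨i, le_rfl, le_rfl, by simpa using hx⟩⟩
  | succ j hij ih =>
    obtain ⟨w, hw⟩ := ih (by omega)
    refine ⟨w.concat (p.adj_getVert_succ (by omega)), fun x hx => ?_⟩
    rw [SimpleGraph.Walk.support_concat, List.mem_append, List.mem_singleton] at hx
    rcases hx with hx | rfl
    · obtain ⟨k, h1, h2, h3⟩ := hw x hx
      exact ⟨k, h1, by omega, h3⟩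
    · exact ⟨j + 1, by omega, le_rfl, rfl⟩

lemma exists_longest_path [Finite V] (v : V) : ∃ (a b : V) (p : H.Walk a b), p.IsPath ∧
    H.Reachable v a ∧ ∀ (a' b' : V) (p' : H.Walk a' b'), p'.IsPath → H.Reachable v a' →
      p'.length ≤ p.length := by
  classical
  have := Fintype.ofFinite V
  let S : Set ℕ := {l | ∃ (a b : V) (p : H.Walk a b), p.IsPath ∧ H.Reachable v a ∧ p.length = l}
  have hne : S.Nonempty := ⟨0, v, v, .nil, .nil, .refl _, rfl⟩
  have hbdd : BddAbove S := by
    refine ⟨Fintype.card V, ?_⟩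
    rintro l ⟨a, b, p, hp, -, rfl⟩
    exact hp.length_lt.le
  obtain ⟨a, b, p, hp, hv, hl⟩ := Nat.sSup_mem hne hbdd
  refine ⟨a, b, p, hp, hv, fun a' b' p' hp' hv' => ?_⟩
  rw [hl]
  exact le_csSup hbdd ⟨a', b', p', hp', hv', rfl⟩

lemma eq_add_one_of_adj_getVert
    (hcyc : ∀ a b c, H.Adj a b → H.Adj b c → a ≠ c → ∀ w : H.Walk a c, b ∉ w.support → False)
    {a b : V} {p : H.Walk a b} (hp : p.IsPath) {i j : ℕ}
    (hij : i ≤ j) (hj : j ≤ p.length) (h : H.Adj (p.getVert i) (p.getVert j)) : j = i + 1 := by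
  by_contra hne
  have hij' : i ≠ j := fun e => h.ne (by rw [e])
  obtain ⟨w, hw⟩ := exists_walk_getVert p (show i + 1 ≤ j by omega) hj
  refine hcyc _ (p.getVert i) _ (p.adj_getVert_succ (by omega)).symm h ?_ w fun hi => ?_
  · exact fun e => hne (hp.getVert_injOn (by simp; omega) (by simpa using hj) e).symm
  · obtain ⟨k, h1, h2, h3⟩ := hw _ hi
    have := hp.getVert_injOn (by simp; omega) (by simp; omega) h3
    omega

/-- In a graph with maximum degree at most two, a longest path of a component all
neighbours of its vertices. -/
lemma exists_getVert_of_adj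
    (hdeg : ∀ v a b c, H.Adj v a → H.Adj v b → H.Adj v c → a ≠ b → a ≠ c → b ≠ c → False)
    {a b : V} {p : H.Walk a b} (hp : p.IsPath)
    (hmax : ∀ (a' b' : V) (p' : H.Walk a' b'), p'.IsPath → H.Reachable a a' →
      p'.length ≤ p.length) {i : ℕ} (hi : i ≤ p.length) {y : V} (h : H.Adj (p.getVert i) y) :
    ∃ j ≤ p.length, p.getVert j = y := by
  by_contra! hy
  have hyp : y ∉ p.support := fun hmem => by
    obtain ⟨j, hj, hj'⟩ := SimpleGraph.Walk.mem_support_iff_exists_getVert.1 hmem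
    exact hy j hj' hj
  rcases Nat.eq_zero_or_pos i with rfl | hpos
  · rw [p.getVert_zero] at h
    have := hmax _ _ (.cons h.symm p) (hp.cons hyp) h.reachable
    simp at this
  · rcases eq_or_lt_of_le hi with rfl | hlt
    · rw [p.getVert_length] at h
      have := hmax _ _ (p.concat h) (hp.concat hyp h) (.refl _)
      simp at this
    · obtain ⟨k, rfl⟩ : ∃ k, i = k + 1 := ⟨i - 1, by omega⟩
      refine hdeg _ _ _ _ (p.adj_getVert_succ (i := k) (by omega)).symm
        (p.adj_getVert_succ (by omega)) h ?_ (hy _ (by omega)) (hy _ (by omega))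
      intro e
      have := hp.getVert_injOn (by simp; omega) (by simp; omega) e
      omega

lemma exists_component_path [Finite V]
    (hdeg : ∀ v a b c, H.Adj v a → H.Adj v b → H.Adj v c → a ≠ b → a ≠ c → b ≠ c → False)
    (hcyc : ∀ a b c, H.Adj a b → H.Adj b c → a ≠ c → ∀ w : H.Walk a c, b ∉ w.support → False)
    (c : H.ConnectedComponent) : ∃ (m : ℕ) (φ : ℕ → V),
    Set.InjOn φ {i | i ≤ m} ∧
    (∀ i ≤ m, ∀ j ≤ m, H.Adj (φ i) (φ j) ↔ i + 1 = j ∨ j + 1 = i) ∧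
    ∀ v, H.connectedComponentMk v = c ↔ ∃ i ≤ m, φ i = v := by
  induction c using SimpleGraph.ConnectedComponent.ind with
  | _ v₀ =>
  obtain ⟨a, b, p, hp, hv, hmax⟩ := exists_longest_path (H := H) v₀
  refine ⟨p.length, p.getVert, hp.getVert_injOn, fun i hi j hj => ⟨fun h => ?_, ?_⟩, fun v => ?_⟩
  · rcases le_total i j with hij | hij
    · exact Or.inl (eq_add_one_of_adj_getVert hcyc hp hij hj h).symm
    · exact Or.inr (eq_add_one_of_adj_getVert hcyc hp hij hi h.symm).symm
  · rintro (rfl | rfl)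
    · exact p.adj_getVert_succ (by omega)
    · exact (p.adj_getVert_succ (by omega)).symm
  · rw [SimpleGraph.ConnectedComponent.eq]
    constructor
    · intro h
      have hclosed : ∀ x y, H.Walk x y → (∃ i ≤ p.length, p.getVert i = x) →
          ∃ i ≤ p.length, p.getVert i = y := by
        intro x y w
        induction w with
        | nil => exact id
        | cons hadj _ ih =>
          rintro ⟨i, hi, rfl⟩
          exact ih (exists_getVert_of_adj hdeg hp
            (fun a' b' p' hp' ha' => hmax a' b' p' hp' (hv.trans ha')) hi hadj)
      obtain ⟨w⟩ := (h.trans hv).symm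
      exact hclosed a v w ⟨0, by omega, p.getVert_zero⟩
    · rintro ⟨i, hi, rfl⟩
      obtain ⟨w, -⟩ := exists_walk_getVert p (Nat.zero_le i) hi
      have : H.Reachable a (p.getVert i) := by simpa using w.reachable
      exact (hv.trans this).symm

/-- A finite graph with maximum degree at most two and without cycles is a disjoint union of
paths. -/
lemma isDisjointUnionOfPaths_of_forall [Finite V]
    (hdeg : ∀ v a b c, H.Adj v a → H.Adj v b → H.Adj v c → a ≠ b → a ≠ c → b ≠ c → False)
    (hcyc : ∀ a b c, H.Adj a b → H.Adj b c → a ≠ c → ∀ w : H.Walk a c, b ∉ w.support → False) :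
    IsDisjointUnionOfPaths H := by
  choose m φ hinj hadj hmem using exists_component_path hdeg hcyc
  have := Fintype.ofFinite H.ConnectedComponent
  let e := (Fintype.equivFin H.ConnectedComponent).symm
  let Φ : (Σ i : Fin (Fintype.card H.ConnectedComponent), Fin (m (e i) + 1)) → V :=
    fun x => φ (e x.1) x.2
  have hcomp : ∀ x, H.connectedComponentMk (Φ x) = e x.1 := fun x =>
    (hmem _ _).2 ⟨x.2, Nat.lt_succ_iff.1 x.2.2, rfl⟩
  have hbij : Function.Bijective Φ := by
    constructor
    · rintro ⟨i, x⟩ ⟨j, y⟩ h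
      obtain rfl : i = j := e.injective (by rw [← hcomp ⟨i, x⟩, ← hcomp ⟨j, y⟩, h])
      have := hinj (e i) (Nat.lt_succ_iff.1 x.2) (Nat.lt_succ_iff.1 y.2) h
      rw [Fin.ext this]
    · intro v
      obtain ⟨i, hi⟩ := e.surjective (H.connectedComponentMk v)
      obtain ⟨x, hx, hxv⟩ := (hmem _ v).1 hi.symm
      exact ⟨⟨i, ⟨x, Nat.lt_succ_iff.2 hx⟩⟩, hxv⟩
  refine ⟨_, fun i => m (e i) + 1, fun i => Nat.le_add_left 1 _, ⟨SimpleGraph.Iso.symm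
    ⟨Equiv.ofBijective Φ hbij, ?_⟩⟩⟩
  rintro ⟨i, x⟩ ⟨j, y⟩
  simp only [Equiv.ofBijective_apply, disjointUnion, SimpleGraph.iSup_adj, SimpleGraph.map_adj,
    SimpleGraph.pathGraph_adj]
  constructor
  · intro h
    obtain rfl : i = j := e.injective (by
      rw [← hcomp ⟨i, x⟩, ← hcomp ⟨j, y⟩]
      exact SimpleGraph.ConnectedComponent.eq.2 h.reachable)
    exact ⟨i, x, y, (hadj (e i) x (Nat.lt_succ_iff.1 x.2) y (Nat.lt_succ_iff.1 y.2)).1 h, rfl, rfl⟩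
  · rintro ⟨k, x', y', h, hx, hy⟩
    cases hx
    cases hy
    exact (hadj (e i) x (Nat.lt_succ_iff.1 x.2) y' (Nat.lt_succ_iff.1 y'.2)).2 h

/-- The vertices of a disjoint union of paths have distinct integer labels such that the labels of
adjacent vertices are consecutive. -/
lemma IsDisjointUnionOfPaths.exists_label (h : IsDisjointUnionOfPaths H) :
    ∃ f : V → ℕ, Function.Injective f ∧ ∀ a b, H.Adj a b → f b = f a + 1 ∨ f a = f b + 1 := by
  obtain ⟨k, l, -, ⟨e⟩⟩ := h
  let M := ∑ i, l i
  have hM : ∀ i, l i ≤ M := fun i => Finset.single_le_sum (fun _ _ => Nat.zero_le _)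
    (Finset.mem_univ i)
  refine ⟨fun v => (e v).2 + M * (e v).1, fun v w hvw => ?_, fun a b hab => ?_⟩
  · have hv : ((e v).2 : ℕ) < M := (e v).2.2.trans_le (hM _)
    have hw : ((e w).2 : ℕ) < M := (e w).2.2.trans_le (hM _)
    have h0 : 0 < M := by omega
    have h1 := congrArg (· / M) hvw
    have h2 := congrArg (· % M) hvw
    simp only [Nat.add_mul_div_left _ _ h0, Nat.div_eq_of_lt hv, Nat.div_eq_of_lt hw, zero_add,
      Nat.add_mul_mod_self_left, Nat.mod_eq_of_lt hv, Nat.mod_eq_of_lt hw] at h1 h2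
    apply e.injective
    revert h1 h2
    generalize e v = x
    generalize e w = y
    obtain ⟨i, x⟩ := x
    obtain ⟨j, y⟩ := y
    intro h1 h2
    dsimp only at h1 h2
    obtain rfl := Fin.ext h1
    rw [Fin.ext h2]
  · have h := e.map_adj_iff.2 hab
    simp only [disjointUnion, SimpleGraph.iSup_adj, SimpleGraph.map_adj,
      SimpleGraph.pathGraph_adj] at h
    obtain ⟨i, x, y, hxy, hx, hy⟩ := h
    revert hx hy
    beta_reduce
    generalize e a = A
    generalize e b = B
    rintro rfl rfl
    change (y : ℕ) + M * i = x + M * i + 1 ∨ (x : ℕ) + M * i = y + M * i + 1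
    omega

end LinearForest

/-- The neighbours of a vertex of an outerplanar graph induce a disjoint union of paths. -/
lemma IsOuterplanar.isDisjointUnionOfPaths [Finite V] (hG : IsOuterplanar G) (u : V) :
    IsDisjointUnionOfPaths (G.induce (G.neighborSet u)) := by
  refine isDisjointUnionOfPaths_of_forall ?_ ?_
  · rintro ⟨v, hv⟩ ⟨a, ha⟩ ⟨b, hb⟩ ⟨c, hc⟩ hva hvb hvc hab hac hbc
    simp only [SimpleGraph.induce_adj, SimpleGraph.mem_neighborSet, ne_eq, Subtype.mk.injEq]
      at hv ha hb hc hva hvb hvc hab hac hbc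
    have hp : Function.Injective ![a, b, c] := by
      intro i j h
      fin_cases i <;> fin_cases j <;> simp_all [eq_comm]
    have hu : ∀ i, G.Adj u (![a, b, c] i) := by intro i; fin_cases i <;> assumption
    have hv' : ∀ i, G.Adj v (![a, b, c] i) := by intro i; fin_cases i <;> assumption
    refine hG.not_K23 (p := ![a, b, c]) (fun i => (hu i).toWalk) (fun i => (hv' i).toWalk)
      (fun i j hij x hx hx' => ?_) (fun i j hij h => ?_) (fun i j hij h => ?_)
    · simp only [SimpleGraph.Walk.support_cons, SimpleGraph.Walk.support_nil, List.mem_cons,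
        List.not_mem_nil, or_false] at hx hx'
      rcases hx with rfl | rfl <;> rcases hx' with h | h
      · exact hv.ne h
      · exact (hu j).ne h
      · exact (hv' i).ne h.symm
      · exact hij (hp h)
    · simp only [SimpleGraph.Walk.support_cons, SimpleGraph.Walk.support_nil, List.mem_cons,
        List.not_mem_nil, or_false] at h
      rcases h with h | h
      · exact (hu j).ne h.symm
      · exact hij (hp h).symm
    · simp only [SimpleGraph.Walk.support_cons, SimpleGraph.Walk.support_nil, List.mem_cons,
        List.not_mem_nil, or_false] at h
      rcases h with h | h
      · exact (hv' j).ne h.symm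
      · exact hij (hp h).symm
  · rintro a b c hab hbc hac w hb
    let ι := SimpleGraph.Embedding.induce (G := G) (G.neighborSet u)
    have hsupp : ∀ x ∈ (w.map ι.toHom).support, ∃ y ∈ w.support, (y : V) = x := fun x hx => by
      rwa [SimpleGraph.Walk.support_map, List.mem_map] at hx
    refine hG.not_K4 (u := u) a.2 b.2 c.2 hab hbc (fun e => hac (Subtype.ext e))
      (w.map ι.toHom) (fun hu => ?_) (fun h => ?_)
    · obtain ⟨x, -, hx⟩ := hsupp _ hu
      exact G.loopless.irrefl u (by simpa [hx] using x.2)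
    · obtain ⟨x, hx, hxb⟩ := hsupp _ h
      exact hb (Subtype.ext hxb ▸ hx)

end

section

variable {V : Type*} {G : SimpleGraph V}

/-! ### Drawings of cones over linear forests -/

lemma isArc_segment {p q : Plane} (h : p ≠ q) : IsArc (segment ℝ p q) p q := by
  refine ⟨⟨⟨fun t : unitInterval => AffineMap.lineMap p q (t : ℝ), ?_⟩, by simp, by simp⟩, ?_, ?_⟩
  · exact AffineMap.lineMap_continuous.comp continuous_subtype_val
  · intro s t hst
    exact Subtype.ext (AffineMap.lineMap_injective ℝ h hst)
  · rw [segment_eq_image_lineMap]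
    ext z
    simp [Set.mem_image]

/-- The point that represents `v` in the drawing of a cone with apex `u` in which the other vertices
`v` are placed on a horizontal line at abscissa `f v`. -/
noncomputable def conePoint [DecidableEq V] (u : V) (f : V → ℤ) (v : V) : Plane :=
  if v = u then !₂[0, 0] else !₂[(f v : ℝ), 1]

section Cone

variable [DecidableEq V] {u : V} {f : V → ℤ}

lemma conePoint_self : conePoint u f u = !₂[0, 0] := if_pos rfl

lemma conePoint_of_ne {v : V} (h : v ≠ u) : conePoint u f v = !₂[(f v : ℝ), 1] := if_neg h

lemma exists_of_mem_spoke {b : V} (hb : b ≠ u) {z : Plane}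
    (hz : z ∈ segment ℝ (conePoint u f u) (conePoint u f b)) :
    ∃ s : ℝ, 0 ≤ s ∧ s ≤ 1 ∧ z = !₂[s * f b, s] := by
  rw [conePoint_self, conePoint_of_ne hb] at hz
  obtain ⟨r, s, hr, hs, hrs, rfl⟩ := hz
  refine ⟨s, hs, by linarith, ?_⟩
  ext i
  fin_cases i <;> simp

lemma exists_of_mem_rim {a b : V} (ha : a ≠ u) (hb : b ≠ u) (hab : f b = f a + 1) {z : Plane}
    (hz : z ∈ segment ℝ (conePoint u f a) (conePoint u f b)) :
    ∃ x : ℝ, (f a : ℝ) ≤ x ∧ x ≤ f b ∧ z = !₂[x, 1] := by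
  rw [conePoint_of_ne ha, conePoint_of_ne hb, hab] at hz
  obtain ⟨r, s, hr, hs, hrs, rfl⟩ := hz
  obtain rfl : r = 1 - s := by linarith
  refine ⟨f a + s, by linarith, by rw [hab]; push_cast; linarith, ?_⟩
  ext i
  fin_cases i
  · simp
    ring
  · simp

/-- The two kinds of edges in the drawing of a cone over a linear forest. -/
lemma mem_coneArc (hadj : ∀ a b, a ≠ u → b ≠ u → G.Adj a b → f b = f a + 1 ∨ f a = f b + 1)
    (e : G.edgeSet) {z : Plane} (hz : z ∈ convexHull ℝ (conePoint u f '' {v | v ∈ (e : Sym2 V)})) :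
    (∃ b, b ≠ u ∧ (e : Sym2 V) = s(u, b) ∧ ∃ s : ℝ, 0 ≤ s ∧ s ≤ 1 ∧ z = !₂[s * f b, s]) ∨
    (∃ a b, a ≠ u ∧ b ≠ u ∧ (e : Sym2 V) = s(a, b) ∧ f b = f a + 1 ∧
      ∃ x : ℝ, (f a : ℝ) ≤ x ∧ x ≤ f b ∧ z = !₂[x, 1]) := by
  obtain ⟨e, he⟩ := e
  induction e using Sym2.ind with
  | _ a b =>
  have hab : G.Adj a b := he
  have hset : {v | v ∈ s(a, b)} = {a, b} := by ext; simp
  simp only [hset, Set.image_pair, convexHull_pair] at hz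
  by_cases ha : a = u
  · subst ha
    exact Or.inl ⟨b, hab.ne', rfl, exists_of_mem_spoke hab.ne' hz⟩
  by_cases hb : b = u
  · subst hb
    rw [segment_symm] at hz
    exact Or.inl ⟨a, hab.ne, Sym2.eq_swap, exists_of_mem_spoke hab.ne hz⟩
  right
  rcases hadj a b ha hb hab with h | h
  · exact ⟨a, b, ha, hb, rfl, h, exists_of_mem_rim ha hb h hz⟩
  · rw [segment_symm] at hz
    exact ⟨b, a, hb, ha, Sym2.eq_swap, h, exists_of_mem_rim hb ha h hz⟩

lemma vec_inj {x y x' y' : ℝ} (h : (!₂[x, y] : Plane) = !₂[x', y']) : x = x' ∧ y = y' :=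
  ⟨by simpa using congrArg (fun z : Plane => z 0) h, by simpa using congrArg (fun z : Plane => z 1) h⟩

/-- The straight-line drawing of a graph `G` such that the edges of `G - u` join vertices with
consecutive labels. -/
noncomputable def coneDrawing (hf : ∀ a b, a ≠ u → b ≠ u → f a = f b → a = b)
    (hadj : ∀ a b, a ≠ u → b ≠ u → G.Adj a b → f b = f a + 1 ∨ f a = f b + 1) :
    PlaneDrawing G where
  point := conePoint u f
  arc e := convexHull ℝ (conePoint u f '' {v | v ∈ (e : Sym2 V)})
  point_injective a b h := by
    by_cases ha : a = u <;> by_cases hb : b = u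
    · rw [ha, hb]
    · rw [ha, conePoint_self, conePoint_of_ne hb] at h
      exact absurd (vec_inj h).2 (by norm_num)
    · rw [hb, conePoint_self, conePoint_of_ne ha] at h
      exact absurd (vec_inj h).2 (by norm_num)
    · rw [conePoint_of_ne ha, conePoint_of_ne hb] at h
      exact hf a b ha hb (by exact_mod_cast (vec_inj h).1)
  isArc a b h := by
    have hset : {v | v ∈ s(a, b)} = {a, b} := by ext; simp
    simp only [hset, Set.image_pair, convexHull_pair]
    refine isArc_segment fun h' => h.ne ?_
    by_cases ha : a = u <;> by_cases hb : b = u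
    · rw [ha, hb]
    · rw [ha, conePoint_self, conePoint_of_ne hb] at h'
      exact absurd (vec_inj h').2 (by norm_num)
    · rw [hb, conePoint_self, conePoint_of_ne ha] at h'
      exact absurd (vec_inj h').2 (by norm_num)
    · rw [conePoint_of_ne ha, conePoint_of_ne hb] at h'
      exact hf a b ha hb (by exact_mod_cast (vec_inj h').1)
  mem_of_point_mem_arc v e hv := by
    rcases mem_coneArc hadj e hv with ⟨b, hb, he, s, -, -, hs⟩ | ⟨a, b, ha, hb, he, hab, x, h1, h2, hx⟩
    · rw [he, Sym2.mem_iff]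
      by_cases hvu : v = u
      · exact Or.inl hvu
      · rw [conePoint_of_ne hvu] at hs
        obtain ⟨h1, h2⟩ := vec_inj hs
        rw [← h2, one_mul] at h1
        exact Or.inr (hf v b hvu hb (by exact_mod_cast h1))
    · rw [he, Sym2.mem_iff]
      by_cases hvu : v = u
      · rw [hvu, conePoint_self] at hx
        exact absurd (vec_inj hx).2 (by norm_num)
      · rw [conePoint_of_ne hvu] at hx
        rw [← (vec_inj hx).1] at h1 h2
        have h1' : f a ≤ f v := by exact_mod_cast h1
        have h2' : f v ≤ f b := by exact_mod_cast h2
        rcases eq_or_lt_of_le h1' with h | h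
        · exact Or.inl (hf v a hvu ha h.symm)
        · exact Or.inr (hf v b hvu hb (by omega))
  arc_inter_subset e e' hne z hz := by
    have rim : ∀ a b c d : V, a ≠ u → b ≠ u → c ≠ u → d ≠ u → (e : Sym2 V) = s(a, b) →
        (e' : Sym2 V) = s(c, d) → f b = f a + 1 → f d = f c + 1 → f a ≠ f c := by
      intro a b c d ha hb hc hd he he' hab hcd hac
      apply hne
      rw [← Subtype.coe_inj, he, he', hf a c ha hc hac, hf b d hb hd (by omega)]
    rcases mem_coneArc hadj e hz.1 with
      ⟨b, hb, he, s, -, -, rfl⟩ | ⟨a, b, ha, hb, he, hab, x, h1, h2, rfl⟩ <;>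
    rcases mem_coneArc hadj e' hz.2 with
      ⟨d, hd, he', s', -, -, hs⟩ | ⟨c, d, hc, hd, he', hcd, y, h3, h4, hs⟩ <;>
    obtain ⟨hs1, hs2⟩ := vec_inj hs
    · subst hs2
      by_cases hs0 : s = 0
      · exact ⟨u, by rw [conePoint_self, hs0]; simp⟩
      · have hbd : f b = f d := by exact_mod_cast mul_left_cancel₀ hs0 hs1
        exact absurd (Subtype.ext (by rw [he, he', hf b d hb hd hbd])) hne
    · exact ⟨b, by rw [conePoint_of_ne hb, hs2]; simp⟩
    · exact ⟨d, by rw [conePoint_of_ne hd, hs1, ← hs2]; simp⟩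
    · subst hs1
      have hac := rim a b c d ha hb hc hd he he' hab hcd
      have h5 : f a ≤ f d := by exact_mod_cast h1.trans h4
      have h6 : f c ≤ f b := by exact_mod_cast h3.trans h2
      rcases lt_or_gt_of_ne hac with h | h
      · have hbc : f b = f c := by omega
        refine ⟨b, ?_⟩
        rw [conePoint_of_ne hb, le_antisymm h2 (by rw [hbc]; exact h3)]
      · have hda : f d = f a := by omega
        refine ⟨a, ?_⟩
        rw [conePoint_of_ne ha, le_antisymm h1 (by rw [← hda]; exact h4)]

end Cone

/-- A convex unbounded set outside of the drawing lies in the outer face. -/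
lemma PlaneDrawing.subset_outerFace {D : PlaneDrawing G} {K : Set Plane} (hK : Convex ℝ K)
    (hub : ¬ Bornology.IsBounded K) (hd : K ⊆ D.supportᶜ) : K ⊆ D.outerFace := fun _ hz =>
  ⟨hd hz, fun hb => hub (hb.subset (hK.isPreconnected.subset_connectedComponentIn hz hd))⟩

lemma not_isBounded_of_forall {K : Set Plane} (h : ∀ r : ℝ, ∃ z ∈ K, r < z 0) :
    ¬ Bornology.IsBounded K := by
  intro hb
  obtain ⟨R, hR⟩ := hb.exists_norm_le
  obtain ⟨z, hz, hzR⟩ := h R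
  have h1 := PiLp.norm_apply_le z 0
  have h2 := hR z hz
  have h3 := le_abs_self (z 0)
  rw [Real.norm_eq_abs] at h1
  linarith

/-- A graph is outerplanar if all edges outside of the vertex `u` join vertices with consecutive
integer labels. -/
theorem isOuterplanar_of_label [Finite V] (u : V) (f : V → ℤ)
    (hf : ∀ a b, a ≠ u → b ≠ u → f a = f b → a = b)
    (hadj : ∀ a b, a ≠ u → b ≠ u → G.Adj a b → f b = f a + 1 ∨ f a = f b + 1) :
    IsOuterplanar G := by
  classical
  refine ⟨coneDrawing hf hadj, fun v => ?_⟩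
  let D := coneDrawing (G := G) hf hadj
  have hsupp : ∀ z ∈ D.support, 0 ≤ z 1 ∧ z 1 ≤ 1 := by
    rintro z (⟨v, rfl⟩ | hz)
    · change 0 ≤ conePoint u f v 1 ∧ conePoint u f v 1 ≤ 1
      by_cases hv : v = u
      · rw [hv, conePoint_self]; simp
      · rw [conePoint_of_ne hv]; simp
    · obtain ⟨e, hz⟩ := Set.mem_iUnion.1 hz
      rcases mem_coneArc hadj e hz with ⟨b, -, -, s, h0, h1, rfl⟩ | ⟨a, b, -, -, -, -, x, -, -, rfl⟩
      · simpa using ⟨h0, h1⟩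
      · simp
  have hlin : IsLinearMap ℝ fun z : Plane => z 1 := ⟨fun _ _ => rfl, fun _ _ => rfl⟩
  have hup : {z : Plane | 1 < z 1} ⊆ D.outerFace :=
    PlaneDrawing.subset_outerFace (convex_halfSpace_gt hlin 1)
      (not_isBounded_of_forall fun r => ⟨!₂[r + 1, 2], by simp, by simp⟩)
      (fun z hz h => absurd (hsupp z h).2 (not_le.2 hz))
  have hdown : {z : Plane | z 1 < 0} ⊆ D.outerFace :=
    PlaneDrawing.subset_outerFace (convex_halfSpace_lt hlin 0)
      (not_isBounded_of_forall fun r => ⟨!₂[r + 1, -1], by simp, by simp⟩)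
      (fun z hz h => absurd (hsupp z h).1 (not_le.2 hz))
  refine ⟨?_, fun h => (interior_subset h).1 (Or.inl ⟨v, rfl⟩)⟩
  change conePoint u f v ∈ closure D.outerFace
  rw [Metric.mem_closure_iff]
  intro ε hε
  by_cases hv : v = u
  · refine ⟨conePoint u f v - EuclideanSpace.single 1 (ε / 2), hdown ?_, ?_⟩
    · simp [hv, conePoint_self, hε]
    · rw [dist_eq_norm, sub_sub_cancel, PiLp.norm_single, Real.norm_eq_abs,
        abs_of_pos (by positivity)]
      linarith
  · refine ⟨conePoint u f v + EuclideanSpace.single 1 (ε / 2), hup ?_, ?_⟩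
    · simp [conePoint_of_ne hv, hε]
    · rw [dist_eq_norm, sub_add_cancel_left, norm_neg, PiLp.norm_single,
        Real.norm_eq_abs, abs_of_pos (by positivity)]
      linarith

end

/-! ### The spectral radius and quadratic forms -/

section Spectral

variable {V : Type*} {G : SimpleGraph V}

lemma adjacency_of_adj {v w : V} (h : G.Adj v w) : adjacency G v w = 1 := by
  simp [adjacency, SimpleGraph.adjMatrix_apply, h]

lemma adjacency_of_not_adj {v w : V} (h : ¬ G.Adj v w) : adjacency G v w = 0 := by
  simp [adjacency, SimpleGraph.adjMatrix_apply, h]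

lemma adjacency_nonneg (v w : V) : 0 ≤ adjacency G v w := by
  by_cases h : G.Adj v w
  · simp [adjacency_of_adj h]
  · simp [adjacency_of_not_adj h]

lemma adjacency_comm (v w : V) : adjacency G v w = adjacency G w v := by
  by_cases h : G.Adj v w
  · rw [adjacency_of_adj h, adjacency_of_adj h.symm]
  · rw [adjacency_of_not_adj h, adjacency_of_not_adj fun h' => h h'.symm]

variable [Fintype V] [DecidableEq V]

lemma abs_le_rho {μ : ℝ} (h : μ ∈ spectrum ℝ (adjacency G)) : |μ| ≤ rho G := by
  have hfin : (spectrum ℝ (adjacency G)).Finite := Matrix.finite_spectrum _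
  have htop : spectralRadius ℝ (adjacency G) ≠ ⊤ := by
    refine ne_of_lt ?_
    obtain ⟨C, hC⟩ := (hfin.image fun k : ℝ => ‖k‖₊).bddAbove
    exact (iSup₂_le fun k hk => ENNReal.coe_le_coe.2 (hC ⟨k, hk, rfl⟩)).trans_lt
      (ENNReal.coe_lt_top (r := C))
  have hle : (‖μ‖₊ : ENNReal) ≤ spectralRadius ℝ (adjacency G) :=
    le_iSup₂ (f := fun (k : ℝ) (_ : k ∈ spectrum ℝ (adjacency G)) => (‖k‖₊ : ENNReal)) μ h
  simpa [rho] using ENNReal.toReal_mono htop hle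

/-- The spectral radius bounds the quadratic form of the adjacency matrix. -/
lemma sum_sum_le_rho_mul (X : V → ℝ) :
    ∑ v, ∑ w, adjacency G v w * X v * X w ≤ rho G * ∑ v, X v * X v := by
  classical
  have hA : (adjacency G).IsHermitian := Matrix.IsHermitian.ext fun v w => by
    rw [star_trivial, adjacency_comm]
  have hB : ((algebraMap ℝ (Matrix V V ℝ)) (rho G) - adjacency G).PosSemidef := by
    rw [Matrix.posSemidef_iff_isHermitian_and_spectrum_nonneg]
    refine ⟨?_, ?_⟩
    · rw [Matrix.algebraMap_eq_diagonal]
      exact (Matrix.isHermitian_diagonal _).sub hA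
    · rw [← spectrum.singleton_sub_eq]
      rintro _ ⟨_, rfl, μ, hμ, rfl⟩
      exact sub_nonneg.2 ((le_abs_self μ).trans (abs_le_rho hμ))
  have h := hB.dotProduct_mulVec_nonneg X
  rw [Matrix.sub_mulVec, dotProduct_sub, sub_nonneg] at h
  simp only [star_trivial, dotProduct, Matrix.mulVec, Matrix.algebraMap_eq_diagonal,
    Matrix.diagonal_apply, Pi.algebraMap_apply, Algebra.algebraMap_self, RingHom.id_apply,
    ite_mul, zero_mul, Finset.sum_ite_eq, Finset.mem_univ, if_true, Finset.mul_sum] at h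
  rw [Finset.mul_sum]
  calc ∑ v, ∑ w, adjacency G v w * X v * X w = ∑ v, ∑ w, X v * (adjacency G v w * X w) := by
        refine Finset.sum_congr rfl fun v _ => Finset.sum_congr rfl fun w _ => by ring
    _ ≤ ∑ v, X v * (rho G * X v) := h
    _ = ∑ v, rho G * (X v * X v) := Finset.sum_congr rfl fun v _ => by ring

end Spectral

lemma rho_le_spexOP {W : Type*} {F : SimpleGraph W} {n : ℕ} {H : SimpleGraph (Fin n)}
    (hH : IsOuterplanar H) (hF : F.Free H) : rho H ≤ spexOP n F := by
  refine le_csSup ?_ ⟨H, hH, hF, rfl⟩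
  refine ((Set.finite_range fun H : SimpleGraph (Fin n) => rho H).subset ?_).bddAbove
  rintro _ ⟨H, -, -, rfl⟩
  exact ⟨H, rfl⟩

/-! ### Stars -/

lemma isOuterplanar_starGraph {V : Type*} [Finite V] (c : V) :
    IsOuterplanar (SimpleGraph.starGraph c) := by
  have := Fintype.ofFinite V
  refine isOuterplanar_of_label c (fun v => (Fintype.equivFin V v : ℕ)) (fun a b _ _ h => ?_)
    (fun a b ha hb h => ?_)
  · exact (Fintype.equivFin V).injective (Fin.ext (by exact_mod_cast h))
  · rcases (SimpleGraph.starGraph_adj.1 h).2 with h | h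
    · exact absurd h ha
    · exact absurd h hb

lemma sqrt_le_rho_starGraph {V : Type*} [Fintype V] [DecidableEq V] (c : V) :
    Real.sqrt (Fintype.card V - 1) ≤ rho (SimpleGraph.starGraph c) := by
  set r := Real.sqrt (Fintype.card V - 1) with hr
  have hcard : (1 : ℝ) ≤ Fintype.card V := by
    exact_mod_cast Fintype.card_pos_iff.2 ⟨c⟩
  have hrr : r * r = Fintype.card V - 1 := Real.mul_self_sqrt (by linarith)
  -- an eigenvector of the star for the eigenvalue `r`
  let X : V → ℝ := fun v => if v = c then r else 1
  have hX : ∀ v, ∑ w, adjacency (SimpleGraph.starGraph c) v w * X v * X w = r * (X v * X v) := by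
    intro v
    by_cases hv : v = c
    · subst hv
      have h1 : ∀ w, adjacency (SimpleGraph.starGraph v) v w * X v * X w =
          if w = v then 0 else r := by
        intro w
        by_cases hw : w = v
        · rw [adjacency_of_not_adj fun h => h.ne hw.symm]; simp [hw]
        · rw [adjacency_of_adj (SimpleGraph.starGraph_center_adj (Ne.symm hw))]; simp [X, hw]
      simp only [h1, Finset.sum_ite, Finset.sum_const_zero, Finset.sum_const, zero_add]
      have : (Finset.univ.filter fun w => ¬ w = v).card = Fintype.card V - 1 := by
        rw [← Finset.card_univ, ← Finset.card_erase_of_mem (Finset.mem_univ v)]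
        congr 1
        ext; simp
      rw [this, nsmul_eq_mul, Nat.cast_sub (by exact_mod_cast hcard), Nat.cast_one, ← hrr]
      simp [X]
      ring
    · rw [Finset.sum_eq_single c]
      · rw [adjacency_of_adj (SimpleGraph.starGraph_center_adj' (Ne.symm hv))]; simp [X, hv]
      · intro w _ hw
        rw [adjacency_of_not_adj fun h => (SimpleGraph.starGraph_adj.1 h).2.elim hv hw]; simp
      · simp
  have h := sum_sum_le_rho_mul (G := SimpleGraph.starGraph c) X
  simp only [hX, ← Finset.mul_sum] at h
  by_cases h0 : r = 0
  · rw [h0]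
    exact ENNReal.toReal_nonneg
  · refine le_of_mul_le_mul_right h ?_
    refine Finset.sum_pos (fun v _ => ?_) ⟨c, Finset.mem_univ c⟩
    have : X v ≠ 0 := by
      by_cases hv : v = c <;> simp [X, hv, h0]
    exact mul_self_pos.2 this

lemma starGraph_isContained_matchingCone {n t : ℕ} (ht : 1 ≤ t) (htn : 2 * t + 1 ≤ n) (c : Fin n) :
    (SimpleGraph.starGraph c).IsContained (matchingCone n t) := by
  classical
  have hcard : Fintype.card {v : Fin n // v ≠ c} ≤
      Fintype.card ((Σ _ : Fin (t - 1), Fin 2) ⊕ Fin (n - 2 * t + 1)) := by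
    simp [Fintype.card_subtype_compl]
    omega
  obtain ⟨θ⟩ := Function.Embedding.nonempty_of_card_le hcard
  refine ⟨⟨⟨fun v => if h : v = c then .inl 0 else .inr (θ ⟨v, h⟩), ?_⟩, ?_⟩⟩
  · intro a b h
    obtain ⟨hab, rfl | rfl⟩ := SimpleGraph.starGraph_adj.1 h
    · simp [hab.symm, matchingCone, join]
    · simp [hab, matchingCone, join]
  · intro a b h
    by_cases ha : a = c <;> by_cases hb : b = c
    · rw [ha, hb]
    · simp [ha, hb] at h
    · simp [ha, hb] at h
    · simpa [ha, hb] using h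

/-! ### Joining all vertices to one vertex -/

section Dominate

variable {V : Type*} {G : SimpleGraph V} {u : V}

/-- The graph obtained from `G` by deleting all edges at vertices that are neither `u` nor
neighbours of `u`, and then joining these vertices to `u`. -/
def dominate (G : SimpleGraph V) (u : V) : SimpleGraph V where
  Adj a b := a ≠ b ∧ (a = u ∨ b = u ∨ (G.Adj u a ∧ G.Adj u b ∧ G.Adj a b))
  symm := ⟨fun _ _ h => ⟨h.1.symm, by
    rcases h.2 with h | h | h
    · exact Or.inr (Or.inl h)
    · exact Or.inl h
    · exact Or.inr (Or.inr ⟨h.2.1, h.1, h.2.2.symm⟩)⟩⟩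
  loopless := ⟨fun _ h => h.1 rfl⟩

lemma isOuterplanar_dominate [Finite V] (hG : IsOuterplanar G) (u : V) :
    IsOuterplanar (dominate G u) := by
  classical
  have := Fintype.ofFinite V
  obtain ⟨f, hf, hadj⟩ := (hG.isDisjointUnionOfPaths u).exists_label
  -- non-neighbours of `u` get distinct negative labels
  let g : V → ℤ := fun v =>
    if h : G.Adj u v then f ⟨v, h⟩ else - (Fintype.equivFin V v : ℕ) - 1
  have hg : ∀ v (h : G.Adj u v), g v = f ⟨v, h⟩ := fun v h => dif_pos h
  have hg' : ∀ v, ¬ G.Adj u v → g v = - (Fintype.equivFin V v : ℕ) - 1 := fun v h => dif_neg h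
  refine isOuterplanar_of_label u g (fun a b _ _ h => ?_) (fun a b ha hb h => ?_)
  · by_cases h1 : G.Adj u a <;> by_cases h2 : G.Adj u b
    · rw [hg a h1, hg b h2] at h
      exact congrArg Subtype.val (hf (by exact_mod_cast h))
    · rw [hg a h1, hg' b h2] at h
      omega
    · rw [hg' a h1, hg b h2] at h
      omega
    · rw [hg' a h1, hg' b h2] at h
      exact (Fintype.equivFin V).injective (Fin.ext (by omega))
  · rcases h.2 with h | h | ⟨h1, h2, h3⟩
    · exact absurd h ha
    · exact absurd h hb
    · rw [hg a h1, hg b h2]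
      exact_mod_cast hadj ⟨a, h1⟩ ⟨b, h2⟩ h3

/-- If `u` has at least `|V(F)|` neighbours, then a copy of `F` in `dominate G u` can be moved into
`G`: its vertices outside of `N(u) ∪ {u}` are joined to `u` only, and they can be replaced by
neighbours of `u` that are not used. -/
lemma free_dominate [Fintype V] {W : Type*} [Fintype W] {F : SimpleGraph W} (hF : F.Free G)
    {L : Finset V} (hL : ∀ v, v ∈ L ↔ G.Adj u v) (hcard : Fintype.card W ≤ L.card) :
    F.Free (dominate G u) := by
  classical
  rintro ⟨φ⟩
  apply hF
  have hφ : Function.Injective φ := φ.injective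
  have hcard' : Fintype.card {w // φ w ≠ u ∧ ¬ G.Adj u (φ w)} ≤
      Fintype.card {v // v ∈ L ∧ v ∉ Set.range φ} := by
    rw [Fintype.card_subtype, Fintype.card_subtype]
    have h1 : (Finset.univ.filter fun w => φ w ≠ u ∧ ¬ G.Adj u (φ w)).card +
        (Finset.univ.filter fun w => G.Adj u (φ w)).card ≤ Fintype.card W := by
      rw [← Finset.card_union_of_disjoint]
      · exact Finset.card_le_univ _
      · rw [Finset.disjoint_left]
        intro w h h'
        simp only [Finset.mem_filter, Finset.mem_univ, true_and] at h h'
        exact h.2 h'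
    have h2 : L.card ≤ (Finset.univ.filter fun v => v ∈ L ∧ v ∉ Set.range φ).card +
        (Finset.univ.filter fun w => G.Adj u (φ w)).card := by
      rw [← Finset.card_image_of_injective (f := φ) _ hφ]
      refine (Finset.card_le_card fun v hv => ?_).trans (Finset.card_union_le _ _)
      simp only [Finset.mem_union, Finset.mem_filter, Finset.mem_univ, true_and, Finset.mem_image]
      by_cases h : v ∈ Set.range φ
      · obtain ⟨w, rfl⟩ := h
        exact Or.inr ⟨w, (hL _).1 hv, rfl⟩
      · exact Or.inl ⟨hv, h⟩
    omega
  obtain ⟨θ⟩ := Function.Embedding.nonempty_of_card_le hcard'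
  let ψ : W → V := fun w => if h : φ w ≠ u ∧ ¬ G.Adj u (φ w) then θ ⟨w, h⟩ else φ w
  have hψ : ∀ w (h : φ w ≠ u ∧ ¬ G.Adj u (φ w)), ψ w = θ ⟨w, h⟩ := fun w h => dif_pos h
  have hψ' : ∀ w, ¬ (φ w ≠ u ∧ ¬ G.Adj u (φ w)) → ψ w = φ w := fun w h => dif_neg h
  have hadj_u : ∀ w, φ w ≠ u → G.Adj u (ψ w) := by
    intro w hw
    by_cases h : G.Adj u (φ w)
    · rwa [hψ' w fun h' => h'.2 h]
    · rw [hψ w ⟨hw, h⟩]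
      exact (hL _).1 (θ ⟨w, hw, h⟩).2.1
  have hψu : ∀ w, φ w = u → ψ w = u := fun w hw => by
    rw [hψ' w fun h' => h'.1 hw, hw]
  refine ⟨⟨⟨ψ, ?_⟩, ?_⟩⟩
  · intro a b hab
    obtain ⟨hne, h⟩ : (dominate G u).Adj (φ a) (φ b) := φ.toHom.map_adj hab
    rcases h with h | h | ⟨h1, h2, h3⟩
    · rw [hψu a h]
      exact hadj_u b fun h' => hne (h.trans h'.symm)
    · rw [hψu b h]
      exact (hadj_u a fun h' => hne (h'.trans h.symm)).symm
    · rwa [hψ' a fun h' => h'.2 h1, hψ' b fun h' => h'.2 h2]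
  · intro a b hab
    change ψ a = ψ b at hab
    by_cases ha : φ a ≠ u ∧ ¬ G.Adj u (φ a) <;> by_cases hb : φ b ≠ u ∧ ¬ G.Adj u (φ b)
    · rw [hψ a ha, hψ b hb] at hab
      exact congrArg Subtype.val (θ.injective (Subtype.ext hab))
    · rw [hψ a ha, hψ' b hb] at hab
      exact absurd ⟨b, hab.symm⟩ (θ ⟨a, ha⟩).2.2
    · rw [hψ' a ha, hψ b hb] at hab
      exact absurd ⟨a, hab⟩ (θ ⟨b, hb⟩).2.2
    · rw [hψ' a ha, hψ' b hb] at hab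
      exact hφ hab

end Dominate

section Eigenvector

variable {V : Type*} [Fintype V] {G : SimpleGraph V}

/-! ### Counting edges by distance layers -/

lemma sum_layer_le_two (hG : IsOuterplanar G) (hc : G.Connected) {u v : V} {k : ℕ}
    (hk : k ≤ G.dist u v) {P : V → Prop} [DecidablePred P]
    (hP : ∀ w, G.Adj v w → P w → G.dist u w = k) :
    ∑ w, (if P w then adjacency G v w else 0) ≤ 2 := by
  classical
  have h := hG.card_le_two hc hk (Finset.univ.filter fun w => G.Adj v w ∧ P w)
    (fun w hw => by
      simp only [Finset.mem_filter, Finset.mem_univ, true_and] at hw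
      exact ⟨hw.1, hP w hw.1 hw.2⟩)
  calc ∑ w, (if P w then adjacency G v w else 0)
      = ∑ w, (if G.Adj v w ∧ P w then (1 : ℝ) else 0) := by
        refine Finset.sum_congr rfl fun w _ => ?_
        by_cases h1 : G.Adj v w <;> by_cases h2 : P w <;>
          simp [h1, h2, adjacency_of_adj, adjacency_of_not_adj]
    _ = ((Finset.univ.filter fun w => G.Adj v w ∧ P w).card : ℝ) := by
        rw [Finset.sum_boole]
    _ ≤ 2 := by exact_mod_cast h

lemma sum_closer_le_two (hG : IsOuterplanar G) (hc : G.Connected) (u v : V) :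
    ∑ w, (if G.dist u w < G.dist u v then adjacency G v w else 0) ≤ 2 :=
  sum_layer_le_two hG hc (k := G.dist u v - 1) (Nat.sub_le _ _) fun w hw h => by
    have := hw.diff_dist_adj (u := u)
    omega

lemma sum_same_le_two (hG : IsOuterplanar G) (hc : G.Connected) (u v : V) :
    ∑ w, (if G.dist u w = G.dist u v then adjacency G v w else 0) ≤ 2 :=
  sum_layer_le_two hG hc le_rfl fun _ _ h => h

lemma sum_common_le_two (hG : IsOuterplanar G) (hc : G.Connected) {v z : V} (hvz : v ≠ z) :
    ∑ w, adjacency G v w * adjacency G w z ≤ 2 := by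
  classical
  refine le_trans (le_of_eq ?_) (sum_layer_le_two hG hc (u := v) (v := z) (k := 1)
    (hc.pos_dist_of_ne hvz) (P := fun w => G.Adj v w)
    fun w _ h => SimpleGraph.dist_eq_one_iff_adj.2 h)
  refine Finset.sum_congr rfl fun w _ => ?_
  by_cases h : G.Adj v w
  · simp [h, adjacency_of_adj h, adjacency_comm w z]
  · simp [h, adjacency_of_not_adj h]

/-- A connected outerplanar graph with `n` vertices has at most `3 * n` edges. -/
lemma sum_sum_adjacency_le (hG : IsOuterplanar G) (hc : G.Connected) :
    ∑ v, ∑ w, adjacency G v w ≤ 6 * Fintype.card V := by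
  obtain ⟨u⟩ := hc.nonempty
  have hsplit : ∀ v w, adjacency G v w =
      (if G.dist u w < G.dist u v then adjacency G v w else 0) +
      (if G.dist u v < G.dist u w then adjacency G w v else 0) +
      (if G.dist u w = G.dist u v then adjacency G v w else 0) := by
    intro v w
    rcases lt_trichotomy (G.dist u w) (G.dist u v) with h | h | h
    · simp [h, h.not_gt, h.ne]
    · simp [h]
    · simp [h, h.not_gt, h.ne', adjacency_comm v w]
  have hcloser : ∑ v, ∑ w, (if G.dist u w < G.dist u v then adjacency G v w else 0)
      ≤ 2 * Fintype.card V := by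
    refine (Finset.sum_le_sum fun v _ => sum_closer_le_two hG hc u v).trans (le_of_eq ?_)
    simp [mul_comm]
  have hsame : ∑ v, ∑ w, (if G.dist u w = G.dist u v then adjacency G v w else 0)
      ≤ 2 * Fintype.card V := by
    refine (Finset.sum_le_sum fun v _ => sum_same_le_two hG hc u v).trans (le_of_eq ?_)
    simp [mul_comm]
  have hswap : ∑ v, ∑ w, (if G.dist u v < G.dist u w then adjacency G w v else 0) =
      ∑ v, ∑ w, (if G.dist u w < G.dist u v then adjacency G v w else 0) := Finset.sum_comm
  calc ∑ v, ∑ w, adjacency G v w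
      = ∑ v, ∑ w, (if G.dist u w < G.dist u v then adjacency G v w else 0) +
        ∑ v, ∑ w, (if G.dist u v < G.dist u w then adjacency G w v else 0) +
        ∑ v, ∑ w, (if G.dist u w = G.dist u v then adjacency G v w else 0) := by
        rw [← Finset.sum_add_distrib, ← Finset.sum_add_distrib]
        refine Finset.sum_congr rfl fun v _ => ?_
        rw [← Finset.sum_add_distrib, ← Finset.sum_add_distrib]
        exact Finset.sum_congr rfl fun w _ => hsplit v w
    _ ≤ 6 * Fintype.card V := by rw [hswap]; linarith

/-- Two vertices have at most two common neighbours, so that the sum of their degrees is at most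
`n + 2`. -/
lemma sum_adjacency_add_le (hG : IsOuterplanar G) (hc : G.Connected) {u v : V} (huv : u ≠ v) :
    ∑ w, adjacency G v w + ∑ w, adjacency G u w ≤ Fintype.card V + 2 := by
  have h1 : ∀ w, adjacency G v w + adjacency G u w
      ≤ 1 + adjacency G u w * adjacency G w v := by
    intro w
    rw [adjacency_comm w v]
    by_cases h1 : G.Adj v w <;> by_cases h2 : G.Adj u w <;>
      simp [adjacency_of_adj, adjacency_of_not_adj, h1, h2]
  have h2 := sum_common_le_two hG hc huv
  calc ∑ w, adjacency G v w + ∑ w, adjacency G u w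
      = ∑ w, (adjacency G v w + adjacency G u w) := Finset.sum_add_distrib.symm
    _ ≤ ∑ w, (1 + adjacency G u w * adjacency G w v) := Finset.sum_le_sum fun w _ => h1 w
    _ = Fintype.card V + ∑ w, adjacency G u w * adjacency G w v := by
        rw [Finset.sum_add_distrib]; simp
    _ ≤ Fintype.card V + 2 := by linarith

/-! ### Estimates for the eigenvector -/

variable {X : V → ℝ} {r : ℝ}

lemma mul_sum_le (hG : IsOuterplanar G) (hc : G.Connected)
    (hX : ∀ v, ∑ w, adjacency G v w * X w = r * X v) (hX1 : ∀ v, X v ≤ 1) :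
    r * ∑ v, X v ≤ 6 * Fintype.card V := by
  refine le_trans ?_ (sum_sum_adjacency_le hG hc)
  rw [Finset.mul_sum]
  refine Finset.sum_le_sum fun v _ => ?_
  rw [← hX v]
  exact Finset.sum_le_sum fun w _ => mul_le_of_le_one_right (adjacency_nonneg v w) (hX1 w)

/-- The eigenvalue equation for walks of length two: at most two of these join `v` to a given other
vertex. -/
lemma sq_mul_le (hG : IsOuterplanar G) (hc : G.Connected)
    (hX : ∀ v, ∑ w, adjacency G v w * X w = r * X v) (hX0 : ∀ v, 0 ≤ X v) (v : V) :
    r ^ 2 * X v ≤ (∑ w, adjacency G v w) * X v + 2 * ∑ w, X w := by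
  classical
  have h1 : r ^ 2 * X v = ∑ z, (∑ w, adjacency G v w * adjacency G w z) * X z := by
    calc r ^ 2 * X v = ∑ w, adjacency G v w * (r * X w) := by
          rw [pow_two, mul_assoc, ← hX v, Finset.mul_sum]
          exact Finset.sum_congr rfl fun w _ => by ring
      _ = ∑ w, ∑ z, adjacency G v w * adjacency G w z * X z := by
          refine Finset.sum_congr rfl fun w _ => ?_
          rw [← hX w, Finset.mul_sum]
          exact Finset.sum_congr rfl fun z _ => by ring
      _ = ∑ z, ∑ w, adjacency G v w * adjacency G w z * X z := Finset.sum_comm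
      _ = _ := Finset.sum_congr rfl fun z _ => by rw [Finset.sum_mul]
  have h2 : ∀ z, (∑ w, adjacency G v w * adjacency G w z) * X z ≤
      (if z = v then (∑ w, adjacency G v w) * X v else 0) + 2 * X z := by
    intro z
    by_cases hz : z = v
    · subst hz
      have : ∑ w, adjacency G z w * adjacency G w z = ∑ w, adjacency G z w := by
        refine Finset.sum_congr rfl fun w _ => ?_
        by_cases h : G.Adj z w
        · rw [adjacency_comm w z, adjacency_of_adj h, one_mul]
        · rw [adjacency_of_not_adj h, zero_mul]
      rw [this, if_pos rfl]
      linarith [hX0 z]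
    · rw [if_neg hz, zero_add]
      exact mul_le_mul_of_nonneg_right (sum_common_le_two hG hc (Ne.symm hz)) (hX0 z)
  rw [h1]
  refine (Finset.sum_le_sum fun z _ => h2 z).trans (le_of_eq ?_)
  rw [Finset.sum_add_distrib, Finset.sum_ite_eq', if_pos (Finset.mem_univ v), ← Finset.mul_sum]

/-- If all entries of `X` except `X u = 1` are small, then `dominate G u` has a larger quadratic form
than `G`: a deleted edge is charged to its end point that is farther from `u`, and each vertex pays
for at most four edges. -/
lemma sum_sum_lt_dominate (hG : IsOuterplanar G) (hc : G.Connected) {u : V} (hX0 : ∀ v, 0 < X v)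
    (hu : X u = 1) (hsmall : ∀ v, v ≠ u → X v ≤ 1 / 5) (hne : ∃ b, b ≠ u ∧ ¬ G.Adj u b) :
    ∑ v, ∑ w, adjacency G v w * X v * X w <
      ∑ v, ∑ w, adjacency (dominate G u) v w * X v * X w := by
  classical
  let B : V → Prop := fun b => b ≠ u ∧ ¬ G.Adj u b
  -- the change of the quadratic form that is charged to `a`, at the ordered pair `(a, b)`
  let g : V → V → ℝ := fun a b => if B a then
    (if b = u then X a else 0) -
      (if G.dist u b ≤ G.dist u a then adjacency G a b * X a * X b else 0) else 0
  have hdist : ∀ a b, B a → G.Adj a b → G.dist u a < G.dist u b → B b := by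
    intro a b ha hab hlt
    have h1 := hc.one_lt_dist_of_ne_of_not_adj (Ne.symm ha.1) ha.2
    refine ⟨fun h => ?_, fun h => ?_⟩
    · rw [h, SimpleGraph.dist_self] at hlt
      omega
    · rw [SimpleGraph.dist_eq_one_iff_adj.2 h] at hlt
      omega
  have hnn : ∀ a b, 0 ≤ adjacency G a b * X a * X b := fun a b =>
    mul_nonneg (mul_nonneg (adjacency_nonneg a b) (hX0 a).le) (hX0 b).le
  have hsymm : ∀ a b, adjacency G a b * X a * X b = adjacency G b a * X b * X a := fun a b => by
    rw [adjacency_comm]; ring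
  have hpair : ∀ a b, g a b + g b a ≤
      adjacency (dominate G u) a b * X a * X b - adjacency G a b * X a * X b := by
    have hB : ∀ a b, B a → g a b + g b a ≤
        adjacency (dominate G u) a b * X a * X b - adjacency G a b * X a * X b := by
      intro a b ha
      by_cases hbu : b = u
      · subst hbu
        have hnB : ¬ B b := fun h => h.1 rfl
        have hnadj : ¬ G.Adj a b := fun h => ha.2 h.symm
        have hadj' : (dominate G b).Adj a b := ⟨ha.1, Or.inr (Or.inl rfl)⟩
        simp [g, ha, hnB, adjacency_of_not_adj hnadj, adjacency_of_adj hadj', hu]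
      · have hnadj : ¬ (dominate G u).Adj a b := fun h =>
          h.2.elim ha.1 fun h => h.elim hbu fun h => ha.2 h.1
        rw [adjacency_of_not_adj hnadj, zero_mul, zero_mul, zero_sub]
        by_cases hab : G.Adj a b
        · by_cases hd : G.dist u b ≤ G.dist u a
          · have h1 : g a b = - (adjacency G a b * X a * X b) := by simp [g, ha, hbu, hd]
            have h2 : g b a ≤ 0 := by
              have := hnn b a
              simp only [g, if_neg ha.1]
              split_ifs <;> linarith
            linarith
          · have hb := hdist a b ha hab (not_le.1 hd)
            have h1 : g a b = 0 := by simp [g, hbu, hd]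
            have h2 : g b a = - (adjacency G a b * X a * X b) := by
              rw [hsymm a b]
              simp [g, hb, ha.1, (not_le.1 hd).le]
            linarith
        · have hba : ¬ G.Adj b a := fun h => hab h.symm
          simp [g, hbu, ha.1, adjacency_of_not_adj hab, adjacency_of_not_adj hba]
    intro a b
    by_cases ha : B a
    · exact hB a b ha
    by_cases hb : B b
    · have h1 := hB b a hb
      rw [add_comm, hsymm a b, show adjacency (dominate G u) a b * X a * X b =
        adjacency (dominate G u) b a * X b * X a by rw [adjacency_comm]; ring]
      exact h1
    · have hL : ∀ x, ¬ B x → x ≠ u → G.Adj u x := fun x hx hxu => by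
        by_contra h
        exact hx ⟨hxu, h⟩
      have hiff : (dominate G u).Adj a b ↔ G.Adj a b := by
        constructor
        · rintro ⟨hab, h | h | h⟩
          · rw [h] at hab ⊢
            exact hL b hb hab.symm
          · rw [h] at hab ⊢
            exact (hL a ha hab).symm
          · exact h.2.2
        · intro h
          refine ⟨h.ne, ?_⟩
          by_cases hau : a = u
          · exact Or.inl hau
          by_cases hbu : b = u
          · exact Or.inr (Or.inl hbu)
          · exact Or.inr (Or.inr ⟨hL a ha hau, hL b hb hbu, h⟩)
      have : adjacency (dominate G u) a b = adjacency G a b := by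
        by_cases h : G.Adj a b
        · rw [adjacency_of_adj h, adjacency_of_adj (hiff.2 h)]
        · rw [adjacency_of_not_adj h, adjacency_of_not_adj (fun h' => h (hiff.1 h'))]
      simp [g, ha, hb, this]
  have hrow : ∀ a, B a → 0 < ∑ b, g a b := by
    intro a ha
    have h1 : ∑ b, g a b = X a - X a * ∑ b,
        (if G.dist u b ≤ G.dist u a then adjacency G a b * X b else 0) := by
      simp only [g, if_pos ha, Finset.sum_sub_distrib, Finset.sum_ite_eq', Finset.mem_univ, if_true,
        Finset.mul_sum]
      congr 1
      refine Finset.sum_congr rfl fun b _ => ?_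
      split_ifs <;> ring
    have h2 : ∑ b, (if G.dist u b ≤ G.dist u a then adjacency G a b * X b else 0) ≤
        ∑ b, ((if G.dist u b < G.dist u a then adjacency G a b else 0) +
          (if G.dist u b = G.dist u a then adjacency G a b else 0)) * (1 / 5) := by
      refine Finset.sum_le_sum fun b _ => ?_
      by_cases hab : G.Adj a b
      · have hbu : b ≠ u := fun h => ha.2 (h ▸ hab.symm)
        have := hsmall b hbu
        rw [adjacency_of_adj hab]
        rcases lt_trichotomy (G.dist u b) (G.dist u a) with h | h | h
        · simpa [h, h.le, h.ne] using this
        · simpa [h] using this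
        · simp [h.not_ge, h.not_gt, h.ne']
      · simp [adjacency_of_not_adj hab]
    rw [← Finset.sum_mul, Finset.sum_add_distrib] at h2
    have h3 := sum_closer_le_two hG hc u a
    have h4 := sum_same_le_two hG hc u a
    have h5 : ∑ b, (if G.dist u b ≤ G.dist u a then adjacency G a b * X b else 0) < 1 := by
      linarith
    rw [h1]
    nlinarith [hX0 a]
  have hrow' : ∀ a, 0 ≤ ∑ b, g a b := by
    intro a
    by_cases ha : B a
    · exact (hrow a ha).le
    · simp [g, ha]
  have hpos : 0 < ∑ a, ∑ b, g a b := by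
    obtain ⟨b, hb⟩ := hne
    exact Finset.sum_pos' (fun a _ => hrow' a) ⟨b, Finset.mem_univ b, hrow b hb⟩
  have hsum : ∑ a, ∑ b, (g a b + g b a) = 2 * ∑ a, ∑ b, g a b := by
    simp only [Finset.sum_add_distrib]
    rw [Finset.sum_comm (f := fun a b => g b a)]
    ring
  have hle : ∑ a, ∑ b, (g a b + g b a) ≤ ∑ a, ∑ b,
      (adjacency (dominate G u) a b * X a * X b - adjacency G a b * X a * X b) :=
    Finset.sum_le_sum fun a _ => Finset.sum_le_sum fun b _ => hpair a b
  simp only [Finset.sum_sub_distrib] at hle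
  linarith

end Eigenvector

end Spex

open Spex in
theorem theorem1 {W : Type*} [Fintype W] (F : SimpleGraph W) (n t : ℕ)
    (hF : Spex.IsOuterplanar F)
    (hF_fan : F.IsContained (Spex.fan n))
    (hF_cone : ¬ F.IsContained (Spex.matchingCone n t))
    (ht : 1 ≤ t) (htn : (t : ℝ) ≤ ((n : ℝ) - 1) / 2)
    (hn : (n : ℝ) ≥ max (1.27 * 10 ^ 7) ((Real.sqrt (64 + (Fintype.card W : ℝ)) + 8) ^ 2))
    (G : SimpleGraph (Fin n)) (hG : G.Connected) (hG_ext : Spex.IsExtremalOP F G)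
    (X : Fin n → ℝ) (hX_pos : ∀ v, 0 < X v)
    (hX_eig : (Spex.adjacency G).mulVec X = Spex.rho G • X)
    (hX_max : IsGreatest (Set.range X) 1) :
    ∃ u : Fin n, G.neighborSet u = {u}ᶜ ∧ X u = 1 ∧
      (completeBipartiteGraph (Fin 1) (Fin (n - 1))).IsContained G ∧
      Spex.IsDisjointUnionOfPaths (G.induce (G.neighborSet u)) := by
  classical
  obtain ⟨hop, hfree, hspex⟩ := hG_ext
  obtain ⟨⟨u, hu⟩, hX1⟩ := hX_max
  have hX1 : ∀ v, X v ≤ 1 := fun v => hX1 ⟨v, rfl⟩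
  have hX : ∀ v, ∑ w, adjacency G v w * X w = rho G * X v := fun v => congrFun hX_eig v
  -- the lower bound on `n` in terms of `|V(F)|` says that `|V(F)| ≤ n - 16 √n`
  set s := Real.sqrt n with hs
  have hss : s * s = n := Real.mul_self_sqrt (by positivity)
  have hn1 : (1.27 * 10 ^ 7 : ℝ) ≤ n := (le_max_left _ _).trans hn
  have hs1 : 3000 ≤ s := Real.le_sqrt_of_sq_le (by linarith)
  have hcardW : (Fintype.card W : ℝ) ≤ n - 16 * s := by
    set q := Real.sqrt (64 + (Fintype.card W : ℝ)) with hq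
    have hqq : q * q = 64 + Fintype.card W := Real.mul_self_sqrt (by positivity)
    have hqs : q + 8 ≤ s := Real.le_sqrt_of_sq_le ((le_max_right _ _).trans hn)
    have hq0 : 0 ≤ q := Real.sqrt_nonneg _
    nlinarith
  -- the star is an admissible graph
  have hrho : (n : ℝ) - 1 ≤ rho G ^ 2 ∧ 0 < rho G := by
    have htn' : 2 * t + 1 ≤ n := by
      have : (2 * t + 1 : ℝ) ≤ n := by linarith
      exact_mod_cast this
    have hstar : F.Free (SimpleGraph.starGraph u) := fun h =>
      hF_cone (h.trans (starGraph_isContained_matchingCone ht htn' u))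
    have h1 : Real.sqrt (n - 1) ≤ rho G := by
      rw [hspex]
      refine le_trans ?_ (rho_le_spexOP (isOuterplanar_starGraph u) hstar)
      simpa using sqrt_le_rho_starGraph u
    have h2 : 0 < Real.sqrt ((n : ℝ) - 1) := Real.sqrt_pos.2 (by linarith)
    exact ⟨(Real.sqrt_le_left (h2.le.trans h1)).1 h1, h2.trans_le h1⟩
  obtain ⟨hrho1, hrho0⟩ := hrho
  have hS0 : 0 ≤ ∑ v, X v := Finset.sum_nonneg fun v _ => (hX_pos v).le
  have hS : 2 * ∑ v, X v ≤ 13 * s := by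
    have h1 := mul_sum_le hop hG hX hX1
    rw [Fintype.card_fin] at h1
    -- the factor `12 / 13` absorbs the difference between `√n` and `√(n - 1)`
    have h2 : 12 / 13 * s ≤ rho G := by
      refine (pow_le_pow_iff_left₀ (by positivity) hrho0.le two_ne_zero).1 ?_
      nlinarith
    have h3 : 12 / 13 * s * ∑ v, X v ≤ 6 * (s * s) := by
      rw [hss]
      exact (mul_le_mul_of_nonneg_right h2 hS0).trans h1
    have hs0 : 0 < s := by linarith
    have h4 : s * (2 * ∑ v, X v) ≤ s * (13 * s) := by linarith
    exact le_of_mul_le_mul_left h4 hs0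
  have hdeg : (n : ℝ) - 1 - 13 * s ≤ ∑ w, adjacency G u w := by
    have := sq_mul_le hop hG hX (fun v => (hX_pos v).le) u
    rw [hu] at this
    linarith
  have hsmall : ∀ v, v ≠ u → X v ≤ 1 / 5 := by
    intro v hv
    have h1 := sq_mul_le hop hG hX (fun v => (hX_pos v).le) v
    have h2 := sum_adjacency_add_le hop hG (Ne.symm hv)
    rw [Fintype.card_fin] at h2
    have h3 : (n - 4 - 13 * s) * X v ≤ (rho G ^ 2 - ∑ w, adjacency G v w) * X v :=
      mul_le_mul_of_nonneg_right (by linarith) (hX_pos v).le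
    have h4 : (n - 4 - 13 * s) * X v ≤ 13 * s := by linarith
    by_contra! h5
    have h6 : (n - 4 - 13 * s) * (1 / 5) ≤ (n - 4 - 13 * s) * X v :=
      mul_le_mul_of_nonneg_left h5.le (by nlinarith)
    nlinarith
  have hdom : ∀ b, b ≠ u → G.Adj u b := by
    by_contra! hne
    have hlt := sum_sum_lt_dominate hop hG hX_pos hu hsmall hne
    have hcard : Fintype.card W ≤ (Finset.univ.filter fun v => G.Adj u v).card := by
      have h1 : ∑ w, adjacency G u w = ((Finset.univ.filter fun v => G.Adj u v).card : ℝ) := by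
        rw [← Finset.sum_boole]
        refine Finset.sum_congr rfl fun w _ => ?_
        by_cases h : G.Adj u w <;> simp [h, adjacency_of_adj, adjacency_of_not_adj]
      rw [h1] at hdeg
      have : (Fintype.card W : ℝ) ≤ ((Finset.univ.filter fun v => G.Adj u v).card : ℝ) := by
        linarith
      exact_mod_cast this
    have hle : rho (dominate G u) ≤ rho G := by
      rw [hspex]
      exact rho_le_spexOP (isOuterplanar_dominate hop u)
        (free_dominate hfree (L := Finset.univ.filter fun v => G.Adj u v) (by simp) hcard)
    have h1 : ∑ v, ∑ w, adjacency G v w * X v * X w = rho G * ∑ v, X v * X v := by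
      rw [Finset.mul_sum]
      refine Finset.sum_congr rfl fun v _ => ?_
      rw [← mul_assoc, ← hX v, Finset.sum_mul]
      exact Finset.sum_congr rfl fun w _ => by ring
    have h2 := sum_sum_le_rho_mul (G := dominate G u) X
    have h3 : rho (dominate G u) * ∑ v, X v * X v ≤ rho G * ∑ v, X v * X v :=
      mul_le_mul_of_nonneg_right hle (Finset.sum_nonneg fun v _ => mul_self_nonneg _)
    linarith
  refine ⟨u, ?_, hu, ?_, hop.isDisjointUnionOfPaths u⟩
  · ext v
    exact ⟨fun h => (G.ne_of_adj h).symm, fun h => hdom v h⟩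
  · have hcard : Fintype.card (Fin (n - 1)) = Fintype.card {v : Fin n // v ≠ u} := by
      simp [Fintype.card_subtype_compl]
    let e := Fintype.equivOfCardEq hcard
    refine ⟨⟨⟨Sum.elim (fun _ => u) (fun i => (e i : Fin n)), ?_⟩, ?_⟩⟩
    · rintro (i | i) (j | j) h
      · simp at h
      · exact hdom _ (e j).2
      · exact (hdom _ (e i).2).symm
      · simp at h
    · rintro (i | i) (j | j) h
      · rw [Subsingleton.elim i j]
      · exact absurd h.symm (e j).2
      · exact absurd h (e i).2
      · exact congrArg Sum.inr (e.injective (Subtype.ext h))
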